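/- Let $F$ be a non-archimedean locally compact field, $D$ a central division algebra of finite dimension over $F$, $\mathcal O_D$ its ring of integers, $\varpi$ a uniformizer of $\mathcal O_D$, $\wp_D=\varpi\mathcal O_D$ and $q=|\mathcal O_D/\wp_D|$. Let $m\ge 1$, $G=GL_m(D)$, $K=GL_m(\mathcal O_D)$ and $K^1=\mathbb I_m+M_m(\wp_D)$. Let $U$ (resp. $U^-$) be the group of upper (resp. lower) unipotent matrices in $K$. The group $W=\mathfrak S_m$ is embedded in $G$ by permutation matrices ($w$ sends the basis vector $e_j$ to $e_{w(j)}$), and $\ell$ is its length function relative to the transpositions $s_j=(j,j+1)$, $1\le j\le m-1$. For $0\le i\le m$ let $\tau_i=\mathrm{diag}(1,\dots,1,\varpi,\dots,\varpi)\in G$, with $i$ entries equal to $1$ and $m-i$ entries equal to $\varpi$; for $X\subset\{0,\dots,m\}$ let $\tau_X=\prod_{x\in X}\tau_x$. The pair $(G,K^1)$ is a Hecke pair, that is, each double coset $K^1gK^1$ is a finite union of left cosets $xK^1$. Let $\mathscr H(G,K^1)$ be its Hecke algebra: the $\mathbb Z$-algebra of $K^1$-bi-invariant functions $G\to\mathbb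 Z$ whose support is a finite union of $K^1$-double cosets, with product $(\Phi_1\Phi_2)(g)=\sum_{x\in G/K^1}\Phi_1(x)\Phi_2(x^{-1}g)$. For $x\in G$ let $f_x$ be the characteristic function of $K^1xK^1$. Let $\alpha=\alpha_{i,i+1}$ ($1\le i\le m-1$) be a simple root, put $\tau_\alpha=\tau_i$, let $W_{\widehat\alpha}$ be the subgroup of $W$ generated by the $s_j$ with $j\ne i$, and let $w\in W$ be of minimal length in $wW_{\widehat\alpha}$. Set $A=\{w(j): i+1\le j\le m\}$, $B=\{w(j)-1: i+1\le j\le m\}$, $P(w,\alpha)=(A\setminus B)\cap\{1,\dots,m-1\}$ and $Q(w,\alpha)=B\setminus A$. Then for every system of representatives $R\subset U\cap wU^-w^{-1}$ of $(U\cap wU^-w^{-1})K^1/K^1$, the set $R$ is finite and $$f_{\tau_{P(w,\alpha)}}\,f_w\,f_{\tau_\alpha}\,f_{w^{-1}}=q^{\ell(w)}\,f_{\tau_{Q(w,\alpha)}}\sum_{u\in R}f_u\qquad\text{in }\mathscr H(G,K^1).$$ -/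

import Mathlib

open Polynomial ValuativeRel

theorem norm_one_add_le {F : Type*} [NontriviallyNormedField F] [IsUltrametricDist F]
    [CompleteSpace F] {D : Type*} [DivisionRing D] [Algebra F D] [FiniteDimensional F D] (x : D)
    (hx : ‖Algebra.norm F x‖ ≤ 1) : ‖Algebra.norm F (1 + x)‖ ≤ 1 := by
  classical
  let Ω := AlgebraicClosure F
  let b := Module.finBasis F D
  let M := Algebra.leftMulMatrix b x
  let N : Matrix _ _ Ω := M.map (algebraMap F Ω)
  let s : MulAlgebraNorm F Ω := spectralMulAlgNorm F Ω
  have hs1 : s 1 = 1 := map_one s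
  have hsF : ∀ c : F, s (algebraMap F Ω c) = ‖c‖ := fun c => spectralNorm_extends c
  have hsneg : ∀ y, s (-y) = s y := fun y => map_neg_eq_map s y
  have hna : ∀ y z, s (y + z) ≤ max (s y) (s z) := fun y z => isNonarchimedean_spectralNorm y z
  have hn : (algebraMap F Ω) (Algebra.norm F x) = N.det := by
    rw [Algebra.norm_eq_matrix_det b, RingHom.map_det]; rfl
  have hn1 : (algebraMap F Ω) (Algebra.norm F (1 + x)) = (1 + N).det := by
    rw [Algebra.norm_eq_matrix_det b, RingHom.map_det, map_add, map_add, map_one, map_one]; rfl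
  have hsprod : ∀ R : Multiset Ω, s R.prod = (R.map s).prod := fun R => by
    exact map_multiset_prod (s : MulAlgebraNorm F Ω) R
  have hint : IsIntegral F x := Algebra.IsIntegral.isIntegral x
  have hroot : ∀ r ∈ N.charpoly.roots, s r = spectralValue (minpoly F x) := by
    intro r hr
    have hr0 : N.charpoly.eval r = 0 := (mem_roots'.1 hr).2
    have h1 : aeval M (minpoly F x) = 0 := by
      have := congrArg (Algebra.leftMulMatrix b) (minpoly.aeval F x)
      rw [map_zero] at this
      rw [← this]
      exact (Polynomial.aeval_algHom_apply (Algebra.leftMulMatrix b) x (minpoly F x))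
    have h2 : aeval r (minpoly F x) = 0 := by
      have hN0 : aeval N ((minpoly F x).map (algebraMap F Ω)) = 0 := by
        rw [aeval_map_algebraMap]
        have h3 := Polynomial.aeval_algHom_apply
          ((Algebra.ofId F Ω).mapMatrix (m := Fin (Module.finrank F D))) M (minpoly F x)
        rw [h1, map_zero] at h3
        exact h3
      have h4 := spectrum.subset_polynomial_aeval N ((minpoly F x).map (algebraMap F Ω))
        ⟨r, Matrix.mem_spectrum_of_isRoot_charpoly hr0, rfl⟩
      rw [hN0] at h4
      have hne : Nontrivial (Matrix (Fin (Module.finrank F D)) (Fin (Module.finrank F D)) Ω) := by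
        have : Nonempty (Fin (Module.finrank F D)) := ⟨⟨0, Module.finrank_pos⟩⟩
        infer_instance
      rw [spectrum.zero_eq, Set.mem_singleton_iff] at h4
      simpa [aeval_def, eval_map] using h4
    have h3 : minpoly F r = minpoly F x :=
      (minpoly.eq_of_irreducible_of_monic (minpoly.irreducible hint) h2 (minpoly.monic hint)).symm
    show spectralValue (minpoly F r) = _
    rw [h3]
  have hroot1 : ∀ r ∈ N.charpoly.roots, s r ≤ 1 := by
    intro r hr
    have h1 : s N.det = spectralValue (minpoly F x) ^ Multiset.card N.charpoly.roots := by
      rw [Matrix.det_eq_prod_roots_charpoly, hsprod, Multiset.map_congr rfl hroot]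
      simp
    rw [← hn, hsF] at h1
    rw [hroot r hr]
    by_contra! hlt
    have := one_lt_pow₀ hlt (n := Multiset.card N.charpoly.roots)
      (by rw [Ne, Multiset.card_eq_zero]; rintro h; simp [h] at hr)
    linarith
  have hfin : s ((1 + N).det) ≤ 1 := by
    have h1 : N.charpoly.eval (-1) = (-(1 + N)).det := by
      rw [Matrix.eval_charpoly]; congr 1
      rw [map_neg, map_one, neg_add, sub_eq_add_neg]
    have h2 : s ((1 + N).det) = s (N.charpoly.eval (-1)) := by
      rw [h1, Matrix.det_neg, map_mul, map_pow, hsneg, hs1]; simp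
    rw [h2]
    have hsp := IsAlgClosed.splits N.charpoly
    rw [hsp.eval_eq_prod_roots_of_monic N.charpoly_monic, hsprod, Multiset.map_map]
    refine (Multiset.prod_induction (fun y : ℝ => 0 ≤ y ∧ y ≤ 1) _
      (fun a b ha hb => ⟨mul_nonneg ha.1 hb.1, mul_le_one₀ ha.2 hb.1 hb.2⟩) ⟨by simp, le_rfl⟩ ?_).2
    intro y hy
    obtain ⟨r, hr, rfl⟩ := Multiset.mem_map.1 hy
    refine ⟨apply_nonneg s _, ?_⟩
    have := hna (-1) (-r)
    rw [hsneg, hsneg, hs1, ← sub_eq_add_neg] at this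
    exact this.trans (max_le le_rfl (hroot1 r hr))
  rwa [← hn1, hsF] at hfin

theorem valuation_norm_one_add_le (F : Type*) [Field F] [ValuativeRel F] [TopologicalSpace F]
    [IsNonarchimedeanLocalField F] {D : Type*} [DivisionRing D] [Algebra F D]
    [FiniteDimensional F D] (x : D) (hx : valuation F (Algebra.norm F x) ≤ 1) :
    valuation F (Algebra.norm F (1 + x)) ≤ 1 := by
  let := IsTopologicalAddGroup.rightUniformSpace F
  have := isUniformAddGroup_of_addCommGroup (G := F)
  let : (Valued.v (R := F) (Γ₀ := ValueGroupWithZero F)).RankOne :=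
  { hom' := IsRankLeOne.nonempty.some.emb (R := F).comp MonoidWithZeroHom.ValueGroup₀.embedding
    strictMono' := IsRankLeOne.nonempty.some.strictMono.comp
        MonoidWithZeroHom.ValueGroup₀.embedding_strictMono }
  let : NontriviallyNormedField F := Valued.toNontriviallyNormedField (val := inferInstance)
  have : IsUltrametricDist F := inferInstance
  have : CompleteSpace F := inferInstance
  have key : ∀ y : F, ‖y‖ ≤ 1 ↔ valuation F y ≤ 1 := fun y =>
    Valued.toNormedField.norm_le_one_iff (val := inferInstance)
  rw [← key] at hx ⊢
  exact norm_one_add_le x hx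

/-- The valuation of a finite-dimensional division algebra `D` over a non-archimedean local field
`F`, written multiplicatively: `x ↦ |N_{D/F}(x)|`, where `N_{D/F}(x)` is the determinant of the left
multiplication by `x` (for central `D` of reduced degree `d`, the `d`-th power of the reduced
norm). -/
noncomputable def divisionValuation (F : Type*) [Field F] [ValuativeRel F] [TopologicalSpace F]
    [IsNonarchimedeanLocalField F] (D : Type*) [DivisionRing D] [Algebra F D]
    [FiniteDimensional F D] : Valuation D (ValueGroupWithZero F) where
  toFun x := valuation F (Algebra.norm F x)
  map_zero' := by rw [Algebra.norm_zero, map_zero]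
  map_one' := by rw [map_one, map_one]
  map_mul' x y := by rw [map_mul, map_mul]
  map_add_le_max' x y := by
    have key : ∀ a b : D, valuation F (Algebra.norm F a) ≤ valuation F (Algebra.norm F b) →
        valuation F (Algebra.norm F (a + b)) ≤ valuation F (Algebra.norm F b) := by
      intro a b hab
      by_cases hb : b = 0
      · subst hb
        simpa [Algebra.norm_zero] using hab
      · have hbN : valuation F (Algebra.norm F b) ≠ 0 := by
          rw [Valuation.ne_zero_iff]
          intro h0
          have h1 : Algebra.norm F b * Algebra.norm F b⁻¹ = 1 := by
            rw [← map_mul, mul_inv_cancel₀ hb, map_one]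
          rw [h0, zero_mul] at h1
          exact zero_ne_one h1
        have hab' : a * b⁻¹ * b = a := by rw [mul_assoc, inv_mul_cancel₀ hb, mul_one]
        have h2 : valuation F (Algebra.norm F (a * b⁻¹)) ≤ 1 := by
          rw [← hab', map_mul, map_mul] at hab
          exact le_of_mul_le_mul_right (by simpa using hab) (zero_lt_iff.2 hbN)
        have h3 := valuation_norm_one_add_le F _ h2
        have h4 : a + b = (1 + a * b⁻¹) * b := by rw [add_mul, hab', one_mul, add_comm]
        rw [h4, map_mul, map_mul]
        exact mul_le_of_le_one_left' h3
    rcases le_total (valuation F (Algebra.norm F x)) (valuation F (Algebra.norm F y)) with h | h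
    · exact (key x y h).trans (le_max_right _ _)
    · rw [add_comm]; exact (key y x h).trans (le_max_left _ _)

/-- `(G, H)` is a Hecke pair: every double coset `HgH` is a finite union of left cosets `xH`. -/
def IsHeckePair {G : Type*} [Group G] (H : Subgroup G) : Prop :=
  ∀ g : G, ((QuotientGroup.mk : G → G ⧸ H) '' DoubleCoset.doubleCoset g H H).Finite

/-- The functions of the Hecke algebra: `H`-bi-invariant functions `G → ℤ` whose support is a
finite union of `H`-double cosets. -/
structure IsHeckeFunction {G : Type*} [Group G] (H : Subgroup G) (Φ : G → ℤ) : Prop where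
  biinvariant : ∀ h ∈ H, ∀ h' ∈ H, ∀ g : G, Φ (h * g * h') = Φ g
  support_eq : ∃ s : Set G, s.Finite ∧
    Function.support Φ = ⋃ x ∈ s, DoubleCoset.doubleCoset x (H : Set G) H

/-- The convolution `(Φ * Ψ)(g) = ∑ₓ Φ(x) Ψ(x⁻¹ g)`, where `x` runs over representatives
of `G ⧸ H`. -/
noncomputable def heckeConv {G : Type*} [Group G] (H : Subgroup G) (Φ Ψ : G → ℤ) (g : G) : ℤ :=
  ∑ᶠ x : G ⧸ H, Φ x.out * Ψ (x.out⁻¹ * g)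

section HeckeAux

variable {G : Type*} [Group G] {H : Subgroup G}

theorem apply_out_of_right_invariant {A : Type*} {T : G → A} (hT : ∀ h ∈ H, ∀ g, T (g * h) = T g)
    (g : G) : T (QuotientGroup.mk g : G ⧸ H).out = T g := by
  obtain ⟨h, hh⟩ := QuotientGroup.mk_out_eq_mul H g
  rw [hh, hT _ h.2]

theorem IsHeckeFunction.right {Φ : G → ℤ} (hΦ : IsHeckeFunction H Φ) (h : G) (hh : h ∈ H)
    (g : G) : Φ (g * h) = Φ g := by
  simpa using hΦ.biinvariant 1 H.one_mem h hh g

theorem IsHeckeFunction.left {Φ : G → ℤ} (hΦ : IsHeckeFunction H Φ) (h : G) (hh : h ∈ H)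
    (g : G) : Φ (h * g) = Φ g := by
  simpa using hΦ.biinvariant h hh 1 H.one_mem g

theorem IsHeckeFunction.out {Φ : G → ℤ} (hΦ : IsHeckeFunction H Φ) (g : G) :
    Φ (QuotientGroup.mk g : G ⧸ H).out = Φ g :=
  apply_out_of_right_invariant hΦ.right g

theorem isHeckeFunction_of_finite {Φ : G → ℤ}
    (hΦ : ∀ h ∈ H, ∀ h' ∈ H, ∀ g : G, Φ (h * g * h') = Φ g)
    (hfin : {x : G ⧸ H | Φ x.out ≠ 0}.Finite) : IsHeckeFunction H Φ := by
  refine ⟨hΦ, Quotient.out '' {x : G ⧸ H | Φ x.out ≠ 0}, hfin.image _, ?_⟩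
  ext g
  simp only [Function.mem_support, Set.mem_iUnion, Set.mem_image, DoubleCoset.mem_doubleCoset]
  constructor
  · intro hg
    obtain ⟨h, hh⟩ := QuotientGroup.mk_out_eq_mul H g
    refine ⟨_, ⟨(QuotientGroup.mk g : G ⧸ H), ?_, rfl⟩, 1, H.one_mem, (h : G)⁻¹,
      H.inv_mem h.2, ?_⟩
    · change Φ _ ≠ 0
      rw [hh]
      simpa using (hΦ 1 H.one_mem h h.2 g).trans_ne hg
    · rw [hh]; group
  · rintro ⟨_, ⟨x, hx, rfl⟩, h, hh, h', hh', rfl⟩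
    rw [hΦ h hh h' hh']
    exact hx

theorem IsHeckeFunction.finite (hH : IsHeckePair H) {Φ : G → ℤ} (hΦ : IsHeckeFunction H Φ) :
    {x : G ⧸ H | Φ x.out ≠ 0}.Finite := by
  obtain ⟨s, hs, hsupp⟩ := hΦ.support_eq
  refine (hs.biUnion fun x _ => hH x).subset fun x hx => ?_
  have : x.out ∈ Function.support Φ := hx
  rw [hsupp] at this
  obtain ⟨y, hy, hxy⟩ := Set.mem_iUnion₂.1 this
  exact Set.mem_iUnion₂.2 ⟨y, hy, x.out, hxy, QuotientGroup.out_eq' x⟩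

theorem finsum_translate {T : G → ℤ} (hT : ∀ h ∈ H, ∀ g, T (g * h) = T g) (a : G) :
    ∑ᶠ x : G ⧸ H, T (a * x.out) = ∑ᶠ x : G ⧸ H, T x.out := by
  refine finsum_eq_of_bijective (fun x : G ⧸ H => a • x) (MulAction.bijective a) fun x => ?_
  have h1 : a • x = (QuotientGroup.mk (a * x.out) : G ⧸ H) := by
    conv_lhs => rw [← QuotientGroup.out_eq' x]
    rfl
  rw [h1, apply_out_of_right_invariant hT]

theorem heckeConv_term_right {Φ Ψ : G → ℤ} (hΦ : IsHeckeFunction H Φ)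
    (hΨ : IsHeckeFunction H Ψ) (g : G) :
    ∀ h ∈ H, ∀ x, Φ (x * h) * Ψ ((x * h)⁻¹ * g) = Φ x * Ψ (x⁻¹ * g) := by
  intro h hh x
  rw [hΦ.right h hh, mul_inv_rev, mul_assoc, hΨ.left _ (H.inv_mem hh)]

theorem IsHeckeFunction.conv (hH : IsHeckePair H) {Φ Ψ : G → ℤ} (hΦ : IsHeckeFunction H Φ)
    (hΨ : IsHeckeFunction H Ψ) : IsHeckeFunction H (heckeConv H Φ Ψ) := by
  apply isHeckeFunction_of_finite
  · intro h hh h' hh' g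
    unfold heckeConv
    refine (finsum_translate (T := fun x => Φ x * Ψ (x⁻¹ * (h * g * h')))
      (heckeConv_term_right hΦ hΨ _) h).symm.trans ?_
    refine finsum_congr fun x => ?_
    rw [hΦ.left h hh]
    congr 1
    rw [show (h * x.out)⁻¹ * (h * g * h') = x.out⁻¹ * g * h' by group, hΨ.right h' hh']
  · refine ((hΦ.finite hH).biUnion fun x _ =>
      (hΨ.finite hH).image fun y : G ⧸ H => x.out • y).subset fun y hy => ?_
    obtain ⟨x, hx⟩ : ∃ x : G ⧸ H, Φ x.out * Ψ (x.out⁻¹ * y.out) ≠ 0 := by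
      by_contra! hcon
      exact hy (finsum_eq_zero_of_forall_eq_zero hcon)
    refine Set.mem_iUnion₂.2 ⟨x, left_ne_zero_of_mul hx,
      QuotientGroup.mk (x.out⁻¹ * y.out), ?_, ?_⟩
    · change Ψ _ ≠ 0
      rw [hΨ.out]
      exact right_ne_zero_of_mul hx
    · change (QuotientGroup.mk (x.out * (x.out⁻¹ * y.out)) : G ⧸ H) = y
      rw [mul_inv_cancel_left]
      exact QuotientGroup.out_eq' y

theorem IsHeckeFunction.conv_finite (hH : IsHeckePair H) {Φ : G → ℤ} (hΦ : IsHeckeFunction H Φ)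
    (F : G ⧸ H → ℤ) : (Function.support fun x : G ⧸ H => Φ x.out * F x).Finite :=
  (hΦ.finite hH).subset fun _ hx => left_ne_zero_of_mul hx

theorem heckeConv_assoc (hH : IsHeckePair H) {Φ Ψ X : G → ℤ} (hΦ : IsHeckeFunction H Φ)
    (hΨ : IsHeckeFunction H Ψ) (hX : IsHeckeFunction H X) :
    heckeConv H (heckeConv H Φ Ψ) X = heckeConv H Φ (heckeConv H Ψ X) := by
  funext g
  let A := (hΦ.finite hH).toFinset
  have hA : ∀ F : G ⧸ H → ℤ, ∑ᶠ x : G ⧸ H, Φ x.out * F x = ∑ x ∈ A, Φ x.out * F x := fun F =>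
    finsum_eq_sum_of_support_subset _ fun x hx => by
      simpa [A] using left_ne_zero_of_mul hx
  have h1 : heckeConv H (heckeConv H Φ Ψ) X g =
      ∑ᶠ y : G ⧸ H, ∑ x ∈ A, Φ x.out * (Ψ (x.out⁻¹ * y.out) * X (y.out⁻¹ * g)) := by
    unfold heckeConv
    refine finsum_congr fun y => ?_
    rw [hA, Finset.sum_mul]
    exact Finset.sum_congr rfl fun x _ => mul_assoc _ _ _
  have h2 : ∀ x : G ⧸ H, ∀ k : G, ∀ h ∈ H, ∀ y,
      Ψ (x.out⁻¹ * (y * h)) * X ((y * h)⁻¹ * k) = Ψ (x.out⁻¹ * y) * X (y⁻¹ * k) := by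
    intro x k h hh y
    rw [← mul_assoc, hΨ.right h hh, mul_inv_rev, mul_assoc h⁻¹, hX.left _ (H.inv_mem hh)]
  have h3 : ∀ x : G ⧸ H, ∑ᶠ y : G ⧸ H, Ψ (x.out⁻¹ * y.out) * X (y.out⁻¹ * g) =
      heckeConv H Ψ X (x.out⁻¹ * g) := by
    intro x
    refine (finsum_translate (T := fun y => Ψ (x.out⁻¹ * y) * X (y⁻¹ * g)) (h2 x g) x.out).symm.trans
      ?_
    unfold heckeConv
    refine finsum_congr fun y => ?_
    rw [inv_mul_cancel_left, mul_inv_rev, mul_assoc]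
  rw [h1, finsum_sum_comm]
  · unfold heckeConv
    rw [hA]
    refine Finset.sum_congr rfl fun x _ => ?_
    rw [← mul_finsum, h3]
    rfl
  · intro x _
    refine ((hΨ.finite hH).image fun y : G ⧸ H => x.out • y).subset fun y hy => ?_
    refine ⟨QuotientGroup.mk (x.out⁻¹ * y.out), ?_, ?_⟩
    · change Ψ _ ≠ 0
      rw [hΨ.out]
      exact left_ne_zero_of_mul (right_ne_zero_of_mul hy)
    · change (QuotientGroup.mk (x.out * (x.out⁻¹ * y.out)) : G ⧸ H) = y
      rw [mul_inv_cancel_left]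
      exact QuotientGroup.out_eq' y

end HeckeAux

/-- The underlying additive group of the Hecke algebra `ℋ(G, H)` of a Hecke pair. -/
def HeckeAlgebra {G : Type*} [Group G] {H : Subgroup G} (hH : IsHeckePair H) :
    AddSubgroup (G → ℤ) where
  carrier := {Φ | IsHeckeFunction H Φ}
  zero_mem' := isHeckeFunction_of_finite (by simp) (by simp)
  add_mem' {Φ Ψ} hΦ hΨ := isHeckeFunction_of_finite
    (fun h hh h' hh' g => by
      simp only [Pi.add_apply, hΦ.biinvariant h hh h' hh' g, hΨ.biinvariant h hh h' hh' g])
    (((hΦ.finite hH).union (hΨ.finite hH)).subset fun x hx => by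
      by_contra hcon
      simp only [Set.mem_union, Set.mem_ofPred_eq, not_or, not_not] at hcon
      exact hx (by simp [hcon.1, hcon.2]))
  neg_mem' {Φ} hΦ := isHeckeFunction_of_finite
    (fun h hh h' hh' g => by simp only [Pi.neg_apply, hΦ.biinvariant h hh h' hh' g])
    ((hΦ.finite hH).subset fun x hx => by simpa using hx)

theorem isHeckeFunction_indicator {G : Type*} [Group G] {H : Subgroup G} (x : G) :
    IsHeckeFunction H (Set.indicator (DoubleCoset.doubleCoset x (H : Set G) H) 1) where
  biinvariant h hh h' hh' g := by
    have : h * g * h' ∈ DoubleCoset.doubleCoset x (H : Set G) H ↔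
        g ∈ DoubleCoset.doubleCoset x (H : Set G) H := by
      simp only [DoubleCoset.mem_doubleCoset]
      constructor
      · rintro ⟨a, ha, b, hb, hab⟩
        refine ⟨h⁻¹ * a, H.mul_mem (H.inv_mem hh) ha, b * h'⁻¹, H.mul_mem hb (H.inv_mem hh'), ?_⟩
        rw [show h⁻¹ * a * x * (b * h'⁻¹) = h⁻¹ * (a * x * b) * h'⁻¹ by group, ← hab]
        group
      · rintro ⟨a, ha, b, hb, rfl⟩
        exact ⟨h * a, H.mul_mem hh ha, b * h', H.mul_mem hb hh', by group⟩
    classical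
    simp only [Set.indicator_apply, this, Pi.one_apply]
  support_eq := ⟨{x}, Set.finite_singleton x, by
    rw [Set.biUnion_singleton, Set.support_indicator]; ext; simp⟩

/-- The characteristic function `f_x` of the double coset `HxH`. -/
noncomputable def heckeChar {G : Type*} [Group G] {H : Subgroup G} (hH : IsHeckePair H) (x : G) :
    HeckeAlgebra hH :=
  ⟨Set.indicator (DoubleCoset.doubleCoset x (H : Set G) H) 1, isHeckeFunction_indicator x⟩

theorem isHeckeFunction_one {G : Type*} [Group G] {H : Subgroup G} :
    IsHeckeFunction H (Set.indicator (H : Set G) 1) := by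
  have h : DoubleCoset.doubleCoset (1 : G) (H : Set G) H = H := by
    ext g
    simp only [DoubleCoset.mem_doubleCoset, mul_one]
    exact ⟨fun ⟨a, ha, b, hb, hab⟩ => hab ▸ H.mul_mem ha hb,
      fun hg => ⟨g, hg, 1, H.one_mem, by simp⟩⟩
  simpa [h] using isHeckeFunction_indicator (H := H) (1 : G)

/-- The ring structure of `ℋ(G, H)`: the product is convolution, and the identity is the
characteristic function of `H`. -/
noncomputable instance HeckeAlgebra.instRing {G : Type*} [Group G] {H : Subgroup G}
    (hH : IsHeckePair H) : Ring (HeckeAlgebra hH) :=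
  { (inferInstance : AddCommGroup (HeckeAlgebra hH)) with
    mul := fun Φ Ψ => ⟨heckeConv H Φ.1 Ψ.1, IsHeckeFunction.conv hH Φ.2 Ψ.2⟩
    one := ⟨Set.indicator (H : Set G) 1, isHeckeFunction_one⟩
    mul_assoc := fun Φ Ψ X => Subtype.ext (heckeConv_assoc hH Φ.2 Ψ.2 X.2)
    left_distrib := fun Φ Ψ X => Subtype.ext <| funext fun g => by
      change ∑ᶠ x : G ⧸ H, Φ.1 x.out * (Ψ.1 _ + X.1 _) = _
      simp only [mul_add]
      exact finsum_add_distrib (Φ.2.conv_finite hH _) (Φ.2.conv_finite hH _)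
    right_distrib := fun Φ Ψ X => Subtype.ext <| funext fun g => by
      change ∑ᶠ x : G ⧸ H, (Φ.1 x.out + Ψ.1 x.out) * X.1 _ = _
      simp only [add_mul]
      exact finsum_add_distrib (Φ.2.conv_finite hH _) (Ψ.2.conv_finite hH _)
    zero_mul := fun Φ => Subtype.ext <| funext fun g => by
      change ∑ᶠ x : G ⧸ H, (0 : ℤ) * Φ.1 _ = 0
      simp
    mul_zero := fun Φ => Subtype.ext <| funext fun g => by
      change ∑ᶠ x : G ⧸ H, Φ.1 x.out * (0 : ℤ) = 0
      simp
    one_mul := fun Φ => Subtype.ext <| funext fun g => by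
      change ∑ᶠ x : G ⧸ H, Set.indicator (H : Set G) 1 x.out * Φ.1 (x.out⁻¹ * g) = Φ.1 g
      rw [finsum_eq_single _ (QuotientGroup.mk 1 : G ⧸ H)]
      · rw [apply_out_of_right_invariant (T := fun x => Set.indicator (H : Set G) 1 x *
          Φ.1 (x⁻¹ * g)) (heckeConv_term_right isHeckeFunction_one Φ.2 g)]
        simp
      · intro x hx
        rw [Set.indicator_of_notMem, zero_mul]
        intro hmem
        apply hx
        rw [← QuotientGroup.out_eq' x]
        exact (QuotientGroup.eq.2 (by simpa using hmem)).symm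
    mul_one := fun Φ => Subtype.ext <| funext fun g => by
      change ∑ᶠ x : G ⧸ H, Φ.1 x.out * Set.indicator (H : Set G) 1 (x.out⁻¹ * g) = Φ.1 g
      rw [finsum_eq_single _ (QuotientGroup.mk g : G ⧸ H)]
      · rw [apply_out_of_right_invariant (T := fun x => Φ.1 x *
          Set.indicator (H : Set G) 1 (x⁻¹ * g)) (heckeConv_term_right Φ.2 isHeckeFunction_one g)]
        simp
      · intro x hx
        rw [Set.indicator_of_notMem, mul_zero]
        intro hmem
        apply hx
        rw [← QuotientGroup.out_eq' x]
        exact QuotientGroup.eq.2 hmem }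

/-- The ring of integers `𝒪_D = {x | |N_{D/F}(x)| ≤ 1}`, which is the maximal order of `D`. -/
noncomputable def integerRing (F : Type*) [Field F] [ValuativeRel F] [TopologicalSpace F]
    [IsNonarchimedeanLocalField F] (D : Type*) [DivisionRing D] [Algebra F D]
    [FiniteDimensional F D] : Subring D :=
  (divisionValuation F D).integer

/-- The prime ideal `℘_D = {x | |N_{D/F}(x)| < 1}` of `𝒪_D`. -/
noncomputable def integerPrime (F : Type*) [Field F] [ValuativeRel F] [TopologicalSpace F]
    [IsNonarchimedeanLocalField F] (D : Type*) [DivisionRing D] [Algebra F D]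
    [FiniteDimensional F D] : Ideal (integerRing F D) where
  carrier := {x | divisionValuation F D x < 1}
  zero_mem' := by simp
  add_mem' hx hy := (divisionValuation F D).map_add_lt hx hy
  smul_mem' c x hx := by
    change divisionValuation F D (c * x : D) < 1
    rw [map_mul]
    exact mul_lt_one_of_nonneg_of_lt_one_right c.2 zero_le hx

/-- The cardinality `q` of the residue field `𝒪_D / ℘_D`. -/
noncomputable def residueCard (F : Type*) [Field F] [ValuativeRel F] [TopologicalSpace F]
    [IsNonarchimedeanLocalField F] (D : Type*) [DivisionRing D] [Algebra F D]
    [FiniteDimensional F D] : ℕ :=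
  Nat.card (integerRing F D ⧸ integerPrime F D)

/-- `ϖ` is a uniformizer of `𝒪_D`: `℘_D = ϖ 𝒪_D` (inside `D`). -/
def IsDivisionUniformizer (F : Type*) [Field F] [ValuativeRel F] [TopologicalSpace F]
    [IsNonarchimedeanLocalField F] {D : Type*} [DivisionRing D] [Algebra F D]
    [FiniteDimensional F D] (ϖ : Dˣ) : Prop :=
  Subtype.val '' (integerPrime F D : Set (integerRing F D)) =
    (fun y : D => (ϖ : D) * y) '' (integerRing F D : Set D)

/-- The maximal compact subgroup `K = GL_m(𝒪_D)` of `GL_m(D)`: the matrices with entries in `𝒪_D`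
whose inverse has entries in `𝒪_D`. -/
noncomputable def maxCompact (F : Type*) [Field F] [ValuativeRel F] [TopologicalSpace F]
    [IsNonarchimedeanLocalField F] (D : Type*) [DivisionRing D] [Algebra F D]
    [FiniteDimensional F D] (m : ℕ) : Subgroup (GL (Fin m) D) where
  carrier := {g | (∀ i j, (g : Matrix (Fin m) (Fin m) D) i j ∈ integerRing F D) ∧
    ∀ i j, ((g⁻¹ : GL (Fin m) D) : Matrix (Fin m) (Fin m) D) i j ∈ integerRing F D}
  one_mem' := by
    have h : ∀ i j, (1 : Matrix (Fin m) (Fin m) D) i j ∈ integerRing F D := fun i j => by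
      rw [Matrix.one_apply]; split_ifs
      exacts [Subring.one_mem _, Subring.zero_mem _]
    exact ⟨h, by simpa using h⟩
  mul_mem' {a b} ha hb := by
    refine ⟨fun i j => ?_, fun i j => ?_⟩
    · rw [Units.val_mul, Matrix.mul_apply]
      exact Subring.sum_mem _ fun k _ => Subring.mul_mem _ (ha.1 i k) (hb.1 k j)
    · rw [mul_inv_rev, Units.val_mul, Matrix.mul_apply]
      exact Subring.sum_mem _ fun k _ => Subring.mul_mem _ (hb.2 i k) (ha.2 k j)
  inv_mem' {a} ha := ⟨ha.2, by simpa using ha.1⟩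

theorem valuation_inv_le_one (F : Type*) [Field F] [ValuativeRel F] [TopologicalSpace F]
    [IsNonarchimedeanLocalField F] {D : Type*} [DivisionRing D] [Algebra F D]
    [FiniteDimensional F D] {m : ℕ} (g : GL (Fin m) D)
    (hg : ∀ i j, divisionValuation F D
      ((g : Matrix (Fin m) (Fin m) D) i j - (1 : Matrix (Fin m) (Fin m) D) i j) < 1) (i j : Fin m) :
    divisionValuation F D (((g⁻¹ : GL (Fin m) D) : Matrix (Fin m) (Fin m) D) i j) ≤ 1 := by
  set v := divisionValuation F D
  set N : Matrix (Fin m) (Fin m) D := ((g⁻¹ : GL (Fin m) D) : Matrix (Fin m) (Fin m) D)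
  obtain ⟨p, -, hp⟩ := Finset.exists_max_image (Finset.univ : Finset (Fin m × Fin m))
    (fun p => v (N p.1 p.2)) ⟨(i, j), Finset.mem_univ _⟩
  by_contra! hlt
  have hγ : 1 < v (N p.1 p.2) := hlt.trans_le (hp (i, j) (Finset.mem_univ _))
  have hN : N = 1 - ((g : Matrix (Fin m) (Fin m) D) - 1) * N := by
    rw [sub_mul, one_mul, ← Units.val_mul, mul_inv_cancel, Units.val_one]; abel
  have h1 : v ((1 : Matrix (Fin m) (Fin m) D) p.1 p.2) < v (N p.1 p.2) := by
    refine lt_of_le_of_lt ?_ hγ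
    rw [Matrix.one_apply]; split_ifs <;> simp
  have h2 : v ((((g : Matrix (Fin m) (Fin m) D) - 1) * N) p.1 p.2) < v (N p.1 p.2) := by
    rw [Matrix.mul_apply]
    refine Valuation.map_sum_lt' v (zero_lt_one.trans hγ) fun k _ => ?_
    rw [map_mul]
    exact (mul_le_mul_right (hp (k, p.2) (Finset.mem_univ _)) _).trans_lt
      (mul_lt_of_lt_one_left (zero_lt_one.trans hγ) (hg _ _))
  have h3 := (v.map_sub _ _).trans_lt (max_lt h1 h2)
  rw [← Matrix.sub_apply, ← hN] at h3
  exact lt_irrefl _ h3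

/-- The pro-`p`-radical `K¹ = 1 + M_m(℘_D)` of `K`. -/
noncomputable def congruenceSubgroup (F : Type*) [Field F] [ValuativeRel F] [TopologicalSpace F]
    [IsNonarchimedeanLocalField F] (D : Type*) [DivisionRing D] [Algebra F D]
    [FiniteDimensional F D] (m : ℕ) : Subgroup (GL (Fin m) D) where
  carrier := {g | ∀ i j, divisionValuation F D
    ((g : Matrix (Fin m) (Fin m) D) i j - (1 : Matrix (Fin m) (Fin m) D) i j) < 1}
  one_mem' := by simp
  mul_mem' {a b} ha hb i j := by
    have h : ((a * b : GL (Fin m) D) : Matrix (Fin m) (Fin m) D) - 1 =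
        ((a : Matrix (Fin m) (Fin m) D) - 1) * ((b : Matrix (Fin m) (Fin m) D) - 1) +
          ((a : Matrix (Fin m) (Fin m) D) - 1) + ((b : Matrix (Fin m) (Fin m) D) - 1) := by
      rw [Units.val_mul]; noncomm_ring
    rw [← Matrix.sub_apply, h]
    refine (divisionValuation F D).map_add_lt ((divisionValuation F D).map_add_lt ?_ (ha i j))
      (hb i j)
    rw [Matrix.mul_apply]
    refine Valuation.map_sum_lt' _ zero_lt_one fun k _ => ?_
    rw [map_mul]
    exact mul_lt_one_of_nonneg_of_lt_one_right (ha i k).le zero_le (hb k j)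
  inv_mem' {a} ha i j := by
    have h : ((a⁻¹ : GL (Fin m) D) : Matrix (Fin m) (Fin m) D) - 1 =
        -(((a⁻¹ : GL (Fin m) D) : Matrix (Fin m) (Fin m) D) *
          ((a : Matrix (Fin m) (Fin m) D) - 1)) := by
      rw [mul_sub, mul_one, ← Units.val_mul, inv_mul_cancel, Units.val_one]; abel
    rw [← Matrix.sub_apply, h, Matrix.neg_apply, Valuation.map_neg, Matrix.mul_apply]
    refine Valuation.map_sum_lt' _ zero_lt_one fun k _ => ?_
    rw [map_mul]
    exact mul_lt_one_of_nonneg_of_lt_one_right (valuation_inv_le_one F a ha i k) zero_le (ha k j)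

/-- The group `U ⊆ K` of upper unipotent matrices. -/
def upperUnipotent (F : Type*) [Field F] [ValuativeRel F] [TopologicalSpace F]
    [IsNonarchimedeanLocalField F] (D : Type*) [DivisionRing D] [Algebra F D]
    [FiniteDimensional F D] (m : ℕ) : Set (GL (Fin m) D) :=
  {u | u ∈ maxCompact F D m ∧ (∀ h, (u : Matrix (Fin m) (Fin m) D) h h = 1) ∧
    ∀ h k, k < h → (u : Matrix (Fin m) (Fin m) D) h k = 0}

/-- The group `U⁻ ⊆ K` of lower unipotent matrices. -/
def lowerUnipotent (F : Type*) [Field F] [ValuativeRel F] [TopologicalSpace F]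
    [IsNonarchimedeanLocalField F] (D : Type*) [DivisionRing D] [Algebra F D]
    [FiniteDimensional F D] (m : ℕ) : Set (GL (Fin m) D) :=
  {u | u ∈ maxCompact F D m ∧ (∀ h, (u : Matrix (Fin m) (Fin m) D) h h = 1) ∧
    ∀ h k, h < k → (u : Matrix (Fin m) (Fin m) D) h k = 0}

/-- The index set of the simple roots `α_{i,i+1}`, `1 ≤ i ≤ m - 1`, of `GL_m`. -/
abbrev SimpleRoot (m : ℕ) : Type := {i : ℕ // 1 ≤ i ∧ i < m}

/-- The simple reflection `s_i = (i, i+1)`. Throughout, `{1, …, m}` is modelled by `Fin m`, with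
`j : Fin m` standing for `j + 1`. -/
def simpleReflection {m : ℕ} (α : SimpleRoot m) : Equiv.Perm (Fin m) :=
  Equiv.swap ⟨α.1 - 1, by have := α.2; omega⟩ ⟨α.1, α.2.2⟩

/-- The length of `w` relative to the simple reflections. -/
noncomputable def weylLength {m : ℕ} (w : Equiv.Perm (Fin m)) : ℕ :=
  sInf {n | ∃ l : List (SimpleRoot m), l.length = n ∧ (l.map simpleReflection).prod = w}

/-- The parabolic subgroup `W_P` generated by the `s_α` with `α ∈ P`. -/
def parabolicSubgroup {m : ℕ} (P : Set (SimpleRoot m)) : Subgroup (Equiv.Perm (Fin m)) :=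
  Subgroup.closure (simpleReflection '' P)

/-- `w` has minimal length in its coset `w W_P`. -/
def IsMinimalInCoset {m : ℕ} (P : Set (SimpleRoot m)) (w : Equiv.Perm (Fin m)) : Prop :=
  ∀ w' ∈ parabolicSubgroup P, weylLength w ≤ weylLength (w * w')

/-- The permutation matrix of `w`, sending the basis vector `e_j` to `e_{w(j)}`. -/
def weylMatrix (D : Type*) [DivisionRing D] {m : ℕ} :
    Equiv.Perm (Fin m) →* GL (Fin m) D where
  toFun w :=
    { val := Matrix.of fun k j => if k = w j then 1 else 0
      inv := Matrix.of fun k j => if k = w⁻¹ j then 1 else 0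
      val_inv := by ext i j; simp [Matrix.mul_apply, Matrix.one_apply]
      inv_val := by ext i j; simp [Matrix.mul_apply, Matrix.one_apply] }
  map_one' := by ext i j; simp only [Matrix.of_apply, Units.val_one, Matrix.one_apply]; rfl
  map_mul' w w' := by
    ext i j
    simp only [Units.val_mul, Matrix.mul_apply, Matrix.of_apply]
    simp only [mul_ite, mul_one, mul_zero, Finset.sum_ite_eq', Finset.mem_univ,
      if_true, Equiv.Perm.mul_apply]
    rfl

/-- `τ_i = diag(1, …, 1, ϖ, …, ϖ)` with `i` entries `1` and `m - i` entries `ϖ`, `0 ≤ i ≤ m`. -/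
def tau {D : Type*} [DivisionRing D] (m : ℕ) (ϖ : Dˣ) (i : ℕ) : GL (Fin m) D where
  val := Matrix.diagonal fun j => if (j : ℕ) < i then 1 else (ϖ : D)
  inv := Matrix.diagonal fun j => if (j : ℕ) < i then 1 else ((ϖ⁻¹ : Dˣ) : D)
  val_inv := by
    rw [Matrix.diagonal_mul_diagonal, ← Matrix.diagonal_one]; congr 1; ext j; split_ifs <;> simp
  inv_val := by
    rw [Matrix.diagonal_mul_diagonal, ← Matrix.diagonal_one]; congr 1; ext j; split_ifs <;> simp

theorem tau_commute {D : Type*} [DivisionRing D] (m : ℕ) (ϖ : Dˣ) (i k : ℕ) :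
    Commute (tau m ϖ i) (tau m ϖ k) := by
  apply Units.ext
  change Matrix.diagonal _ * Matrix.diagonal _ = Matrix.diagonal _ * Matrix.diagonal _
  rw [Matrix.diagonal_mul_diagonal, Matrix.diagonal_mul_diagonal]
  congr 1; ext j; split_ifs <;> simp

theorem tau_pairwise_commute {D : Type*} [DivisionRing D] (m : ℕ) (ϖ : Dˣ) (P : Finset ℕ) :
    (P : Set ℕ).Pairwise (Function.onFun Commute (tau (D := D) m ϖ)) :=
  fun _ _ _ _ _ => tau_commute m ϖ _ _

/-- `τ_P = ∏_{x ∈ P} τ_x` for a set `P` of indices in `{0, …, m}`. -/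
def tauSet {D : Type*} [DivisionRing D] (m : ℕ) (ϖ : Dˣ) (P : Finset ℕ) : GL (Fin m) D :=
  P.noncommProd (tau m ϖ) (tau_pairwise_commute m ϖ P)

/-- `A(w, α) = {w(j) | i + 1 ≤ j ≤ m} ⊆ {1, …, m}` for `α = α_{i,i+1}`. -/
def setA {m : ℕ} (w : Equiv.Perm (Fin m)) (α : SimpleRoot m) : Finset ℕ :=
  (Finset.univ.filter fun j : Fin m => α.1 ≤ (j : ℕ)).image fun j => (w j : ℕ) + 1

/-- `B(w, α) = {w(j) - 1 | i + 1 ≤ j ≤ m} ⊆ {0, …, m - 1}` for `α = α_{i,i+1}`. -/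
def setB {m : ℕ} (w : Equiv.Perm (Fin m)) (α : SimpleRoot m) : Finset ℕ :=
  (Finset.univ.filter fun j : Fin m => α.1 ≤ (j : ℕ)).image fun j => (w j : ℕ)

/-- `P(w, α)`: the simple roots `α_{k,k+1}` with `k ∈ A(w, α) \ B(w, α)`, given by their
indices `k`. -/
def setP {m : ℕ} (w : Equiv.Perm (Fin m)) (α : SimpleRoot m) : Finset ℕ :=
  (setA w α \ setB w α).filter fun k => 1 ≤ k ∧ k < m

/-- `Q(w, α) = B(w, α) \ A(w, α) ⊆ {0, …, m - 1}`. -/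
def setQ {m : ℕ} (w : Equiv.Perm (Fin m)) (α : SimpleRoot m) : Finset ℕ :=
  setB w α \ setA w α

/-- `R` is a system of representatives, contained in `V`, of the left cosets `vH`, `v ∈ V`. -/
def IsCosetRepresentatives {G : Type*} [Group G] (H : Subgroup G) (V R : Set G) : Prop :=
  R ⊆ V ∧ ∀ v ∈ V, ∃! r, r ∈ R ∧ r⁻¹ * v ∈ H

/-!
The four-fold product is computed by moving everything to diagonal matrices. Write `H` for the
congruence subgroup `K¹`, `τ` for `τ_{P(w, α)}` and `t` for `w τ_α w⁻¹`, the diagonal matrix with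
`ϖ` at the indices in `A = A(w, α)` and `1` elsewhere. Permutation matrices normalize `H`, so
`f_w f_{τ_α} f_{w⁻¹} = f_t`, and a comparison of exponents (`tauExponent_setQ`) gives
`τ t = τ_{Q(w, α)}`. What remains is `f_τ f_t = q ^ ℓ(w) ∑ f_{τ t u}`.

Since `w` is minimal in its coset, it is increasing on `{1, …, i}` and on `{i + 1, …, m}`. Hence
`U ∩ w U⁻ w⁻¹` consists of the matrices `1 + N` with `N` integral, supported strictly above the
diagonal on the block `A × Aᶜ` (`exists_isUpperBlock_of_mem_inter`); such `N` have product zero.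
These matrices normalize `H`, and `t` conjugates them into `H`, so that `f_τ f_t` is invariant under
right translation by them. The double cosets `H τ t u H` are distinct for distinct cosets `uH`
(`inv_mul_mem_of_mem_doubleCoset`, because the exponents of `τ t` increase) and cover
`H τ H t H` (`exists_isUpperBlock_tau_mul`), so all coefficients equal the value at `τ t`; this is
the abstract statement `heckeChar_mul_eq_nsmul_sum`.

That value is the number of cosets `zH` in `H τ H` with `z⁻¹ τ t ∈ H t H`. They are the cosets
`τ (1 + N) H` with `N` integral, supported strictly below the diagonal on `Aᶜ × A`, and depend on
`N` modulo `℘_D` only (`exists_lowUnip_of_mem`, `tau_lowUnip_mem`, `lowUnip_inv_mul_mem_iff`): here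
one uses that the exponents of `τ` jump between an index in `A` and a later one outside `A`.
The positions `(h, k)` available to `N` correspond to the inversions of `w`, whose number
is `ℓ(w)` (`card_lowPosition`), which gives `q ^ ℓ(w)` cosets.

The Hecke pair property and the finiteness of `R` rest on the total boundedness of `𝒪_D`
(`exists_finite_cover`), proved by lifting linear independence over the residue field of `F` from
`𝒪_D / π 𝒪_D` to `D`.
-/

/-! ### Products of double cosets in a Hecke algebra -/

section HeckeProducts

variable {G : Type*} [Group G] {H : Subgroup G}

theorem heckeAlgebra_mul_apply (hH : IsHeckePair H) (Φ Ψ : HeckeAlgebra hH) (g : G) :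
    (Φ * Ψ).1 g = ∑ᶠ x : G ⧸ H, Φ.1 x.out * Ψ.1 (x.out⁻¹ * g) := rfl

theorem heckeChar_apply (hH : IsHeckePair H) (x g : G) :
    (heckeChar hH x).1 g = Set.indicator (DoubleCoset.doubleCoset x (H : Set G) H) 1 g := rfl

theorem heckeChar_apply_of_mem (hH : IsHeckePair H) {x g : G}
    (h : g ∈ DoubleCoset.doubleCoset x (H : Set G) H) : (heckeChar hH x).1 g = 1 := by
  rw [heckeChar_apply, Set.indicator_of_mem h]; rfl

theorem heckeChar_apply_of_notMem (hH : IsHeckePair H) {x g : G}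
    (h : g ∉ DoubleCoset.doubleCoset x (H : Set G) H) : (heckeChar hH x).1 g = 0 :=
  Set.indicator_of_notMem h _

theorem heckeChar_apply_congr (hH : IsHeckePair H) {x y g k : G}
    (h : g ∈ DoubleCoset.doubleCoset x (H : Set G) H ↔
      k ∈ DoubleCoset.doubleCoset y (H : Set G) H) :
    (heckeChar hH x).1 g = (heckeChar hH y).1 k := by
  by_cases hg : g ∈ DoubleCoset.doubleCoset x (H : Set G) H
  · rw [heckeChar_apply_of_mem hH hg, heckeChar_apply_of_mem hH (h.1 hg)]
  · rw [heckeChar_apply_of_notMem hH hg, heckeChar_apply_of_notMem hH (fun hk => hg (h.2 hk))]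

theorem heckeChar_congr (hH : IsHeckePair H) {x y : G}
    (h : x ∈ DoubleCoset.doubleCoset y (H : Set G) H) : heckeChar hH x = heckeChar hH y :=
  Subtype.ext <| by
    change Set.indicator _ _ = Set.indicator _ _
    rw [DoubleCoset.doubleCoset_eq_of_mem h]

/-- If `y` normalizes `H`, then `HyH` is the single coset `yH` and `f_x f_y = f_{xy}`. -/
theorem heckeChar_mul_of_normalizer_right (hH : IsHeckePair H) (x : G) {y : G}
    (hy : y ∈ Subgroup.normalizer (H : Set G)) :
    heckeChar hH x * heckeChar hH y = heckeChar hH (x * y) := by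
  have hy1 : ∀ h ∈ H, y * h * y⁻¹ ∈ H := fun h hh => (Subgroup.mem_normalizer_iff.1 hy h).1 hh
  have hy2 : ∀ h ∈ H, y⁻¹ * h * y ∈ H := fun h hh =>
    (Subgroup.mem_normalizer_iff.1 hy _).2 (by simpa [mul_assoc] using hh)
  refine Subtype.ext (funext fun g => ?_)
  rw [heckeAlgebra_mul_apply, finsum_eq_single _ (QuotientGroup.mk (g * y⁻¹) : G ⧸ H)]
  · rw [apply_out_of_right_invariant (T := fun z => (heckeChar hH x).1 z *
      (heckeChar hH y).1 (z⁻¹ * g))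
      (heckeConv_term_right (heckeChar hH x).2 (heckeChar hH y).2 g)]
    rw [heckeChar_apply_of_mem hH (x := y), mul_one]
    · refine heckeChar_apply_congr hH ?_
      simp only [DoubleCoset.mem_doubleCoset]
      constructor
      · rintro ⟨h, hh, k, hk, e⟩
        exact ⟨h, hh, _, hy2 k hk, by rw [← mul_inv_cancel_right g y⁻¹, e]; group⟩
      · rintro ⟨h, hh, k, hk, rfl⟩
        exact ⟨h, hh, _, hy1 k hk, by group⟩
    · rw [DoubleCoset.mem_doubleCoset]
      exact ⟨1, H.one_mem, 1, H.one_mem, by group⟩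
  · intro z hz
    rw [heckeChar_apply_of_notMem hH (x := y), mul_zero]
    rw [DoubleCoset.mem_doubleCoset]
    rintro ⟨h, hh, k, hk, e⟩
    apply hz
    rw [← QuotientGroup.out_eq' z]
    refine QuotientGroup.eq.2 ?_
    have : z.out⁻¹ * (g * y⁻¹) = h * (y * k * y⁻¹) := by rw [← mul_assoc, e]; group
    rw [this]
    exact H.mul_mem hh (hy1 k hk)

theorem heckeChar_mul_of_normalizer_left (hH : IsHeckePair H) {x : G} (y : G)
    (hx : x ∈ Subgroup.normalizer (H : Set G)) :
    heckeChar hH x * heckeChar hH y = heckeChar hH (x * y) := by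
  have hx1 : ∀ h ∈ H, x * h * x⁻¹ ∈ H := fun h hh => (Subgroup.mem_normalizer_iff.1 hx h).1 hh
  have hx2 : ∀ h ∈ H, x⁻¹ * h * x ∈ H := fun h hh =>
    (Subgroup.mem_normalizer_iff.1 hx _).2 (by simpa [mul_assoc] using hh)
  refine Subtype.ext (funext fun g => ?_)
  rw [heckeAlgebra_mul_apply, finsum_eq_single _ (QuotientGroup.mk x : G ⧸ H)]
  · rw [apply_out_of_right_invariant (T := fun z => (heckeChar hH x).1 z *
      (heckeChar hH y).1 (z⁻¹ * g))
      (heckeConv_term_right (heckeChar hH x).2 (heckeChar hH y).2 g)]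
    rw [heckeChar_apply_of_mem hH (DoubleCoset.mem_doubleCoset_self H H x), one_mul]
    refine heckeChar_apply_congr hH ?_
    simp only [DoubleCoset.mem_doubleCoset]
    constructor
    · rintro ⟨h, hh, k, hk, e⟩
      exact ⟨_, hx1 h hh, k, hk, by rw [← mul_inv_cancel_left x g, e]; group⟩
    · rintro ⟨h, hh, k, hk, rfl⟩
      exact ⟨_, hx2 h hh, k, hk, by group⟩
  · intro z hz
    rw [heckeChar_apply_of_notMem hH (x := x), zero_mul]
    rw [DoubleCoset.mem_doubleCoset]
    rintro ⟨h, hh, k, hk, e⟩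
    apply hz
    rw [← QuotientGroup.out_eq' z]
    refine QuotientGroup.eq.2 ?_
    have : z.out⁻¹ * x = k⁻¹ * (x⁻¹ * h⁻¹ * x) := by rw [e]; group
    rw [this]
    exact H.mul_mem (H.inv_mem hk) (hx2 _ (H.inv_mem hh))

/-- The value at `g` of `f_x f_y` counts the cosets `zH ⊆ HxH` with `z⁻¹g ∈ HyH`. -/
theorem heckeChar_mul_heckeChar_apply (hH : IsHeckePair H) (x y g : G) :
    (heckeChar hH x * heckeChar hH y).1 g =
      (((QuotientGroup.mk : G → G ⧸ H) '' {z | z ∈ DoubleCoset.doubleCoset x (H : Set G) H ∧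
        z⁻¹ * g ∈ DoubleCoset.doubleCoset y (H : Set G) H}).ncard : ℤ) := by
  classical
  set S := (QuotientGroup.mk : G → G ⧸ H) '' {z | z ∈ DoubleCoset.doubleCoset x (H : Set G) H ∧
        z⁻¹ * g ∈ DoubleCoset.doubleCoset y (H : Set G) H}
  have key : ∀ z : G ⧸ H, (heckeChar hH x).1 z.out * (heckeChar hH y).1 (z.out⁻¹ * g) =
      Set.indicator S 1 z := by
    intro z
    induction z using QuotientGroup.induction_on with | _ z =>
    rw [apply_out_of_right_invariant (T := fun z => (heckeChar hH x).1 z *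
      (heckeChar hH y).1 (z⁻¹ * g))
      (heckeConv_term_right (heckeChar hH x).2 (heckeChar hH y).2 g)]
    by_cases hz : z ∈ DoubleCoset.doubleCoset x (H : Set G) H ∧
        z⁻¹ * g ∈ DoubleCoset.doubleCoset y (H : Set G) H
    · rw [heckeChar_apply_of_mem hH hz.1, heckeChar_apply_of_mem hH hz.2,
        Set.indicator_of_mem (show (QuotientGroup.mk z : G ⧸ H) ∈ S from ⟨z, hz, rfl⟩)]
      rfl
    · rw [Set.indicator_of_notMem]
      · by_cases h1 : z ∈ DoubleCoset.doubleCoset x (H : Set G) H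
        · rw [heckeChar_apply_of_notMem hH (fun h2 => hz ⟨h1, h2⟩), mul_zero]
        · rw [heckeChar_apply_of_notMem hH h1, zero_mul]
      · rintro ⟨z', ⟨hz1, hz2⟩, e⟩
        have hzz := QuotientGroup.eq.1 e
        apply hz
        simp only [DoubleCoset.mem_doubleCoset] at hz1 hz2 ⊢
        obtain ⟨a, ha, b, hb, e1⟩ := hz1
        obtain ⟨c, hc, d, hd, e2⟩ := hz2
        refine ⟨⟨a, ha, b * (z'⁻¹ * z), H.mul_mem hb hzz, ?_⟩,
          ⟨(z'⁻¹ * z)⁻¹ * c, H.mul_mem (H.inv_mem hzz) hc, d, hd, ?_⟩⟩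
        · rw [← mul_assoc, ← e1]; group
        · rw [show (z'⁻¹ * z)⁻¹ * c * y * d = (z'⁻¹ * z)⁻¹ * (c * y * d) by group, ← e2]; group
  rw [heckeAlgebra_mul_apply, finsum_congr key, ← finsum_mem_def]
  rcases S.finite_or_infinite with hS | hS
  · rw [finsum_mem_eq_finite_toFinset_sum _ hS, Set.ncard_eq_toFinset_card S hS]
    simp
  · rw [finsum_mem_eq_zero_of_infinite (by simpa using hS), hS.ncard, Nat.cast_zero]

/-- If `f_x f_y` is supported on the pairwise distinct double cosets of `xyu`, `u ∈ R`, where the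
`u ∈ R` normalize `H` and are absorbed by `f_y`, then all its coefficients are equal to its
value at `xy`. -/
theorem heckeChar_mul_eq_nsmul_sum (hH : IsHeckePair H) {x y : G} {R : Set G} (hR : R.Finite)
    (hRn : ∀ u ∈ R, u ∈ Subgroup.normalizer (H : Set G)) (hRy : ∀ u ∈ R, y * u * y⁻¹ ∈ H)
    (hcover : ∀ h ∈ H, ∃ u ∈ R,
      x * h * y ∈ DoubleCoset.doubleCoset (x * y * u) (H : Set G) H)
    (hinj : ∀ u ∈ R, ∀ u' ∈ R,
      x * y * u ∈ DoubleCoset.doubleCoset (x * y * u') (H : Set G) H → u = u')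
    {c : ℕ} (hc : ((QuotientGroup.mk : G → G ⧸ H) ''
      {z | z ∈ DoubleCoset.doubleCoset x (H : Set G) H ∧
        z⁻¹ * (x * y) ∈ DoubleCoset.doubleCoset y (H : Set G) H}).ncard = c) :
    heckeChar hH x * heckeChar hH y =
      c • (heckeChar hH (x * y) * ∑ᶠ u ∈ R, heckeChar hH u) := by
  classical
  have hsum : heckeChar hH (x * y) * ∑ᶠ u ∈ R, heckeChar hH u =
      ∑ u ∈ hR.toFinset, heckeChar hH (x * y * u) := by
    rw [finsum_mem_eq_finite_toFinset_sum _ hR, Finset.mul_sum]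
    exact Finset.sum_congr rfl fun u hu =>
      heckeChar_mul_of_normalizer_right hH _ (hRn u (hR.mem_toFinset.1 hu))
  have happ : ∀ g, (c • ∑ u ∈ hR.toFinset, heckeChar hH (x * y * u)).1 g =
      c * ∑ u ∈ hR.toFinset, (heckeChar hH (x * y * u)).1 g := by
    intro g
    rw [AddSubgroup.coe_nsmul, AddSubgroup.val_finsetSum, Pi.smul_apply, Finset.sum_apply,
      nsmul_eq_mul]
  have habs : ∀ u ∈ R, heckeChar hH x * heckeChar hH y * heckeChar hH u =
      heckeChar hH x * heckeChar hH y := by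
    intro u hu
    rw [mul_assoc, heckeChar_mul_of_normalizer_right hH y (hRn u hu),
      heckeChar_congr hH (x := y * u) (y := y)]
    rw [DoubleCoset.mem_doubleCoset]
    exact ⟨_, hRy u hu, 1, H.one_mem, by group⟩
  -- since `f_x f_y = f_x f_y f_u`, its value at `xyu` is its value at `xy`
  have hval : ∀ u ∈ R, (heckeChar hH x * heckeChar hH y).1 (x * y * u) = c := by
    intro u hu
    rw [← hc, ← heckeChar_mul_heckeChar_apply hH]
    set Φ := heckeChar hH x * heckeChar hH y
    have hu1 : ∀ h ∈ H, u * h * u⁻¹ ∈ H := fun h hh =>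
      (Subgroup.mem_normalizer_iff.1 (hRn u hu) h).1 hh
    conv_lhs => rw [← habs u hu]
    rw [heckeAlgebra_mul_apply, finsum_eq_single _ (QuotientGroup.mk (x * y) : G ⧸ H)]
    · rw [apply_out_of_right_invariant (T := fun z => Φ.1 z *
        (heckeChar hH u).1 (z⁻¹ * (x * y * u)))
        (heckeConv_term_right Φ.2 (heckeChar hH u).2 _)]
      rw [inv_mul_cancel_left,
        heckeChar_apply_of_mem hH (DoubleCoset.mem_doubleCoset_self H H u), mul_one]
    · intro z hz
      rw [heckeChar_apply_of_notMem hH (x := u), mul_zero]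
      rw [DoubleCoset.mem_doubleCoset]
      rintro ⟨h, hh, k, hk, e⟩
      apply hz
      rw [← QuotientGroup.out_eq' z]
      refine QuotientGroup.eq.2 ?_
      have : z.out⁻¹ * (x * y) = h * (u * k * u⁻¹) := by
        rw [← mul_inv_cancel_right (z.out⁻¹ * (x * y)) u, mul_assoc z.out⁻¹, e]; group
      rw [this]
      exact H.mul_mem hh (hu1 k hk)
  rw [hsum]
  refine Subtype.ext (funext fun g => ?_)
  rw [happ]
  by_cases hg : ∃ u ∈ R, g ∈ DoubleCoset.doubleCoset (x * y * u) (H : Set G) H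
  · obtain ⟨u, hu, hgu⟩ := hg
    rw [Finset.sum_eq_single u]
    · rw [heckeChar_apply_of_mem hH hgu, mul_one, ← hval u hu]
      rw [DoubleCoset.mem_doubleCoset] at hgu
      obtain ⟨h, hh, k, hk, rfl⟩ := hgu
      exact (heckeChar hH x * heckeChar hH y).2.biinvariant h hh k hk _
    · intro u' hu' hne
      refine heckeChar_apply_of_notMem hH fun hgu' => hne ?_
      refine hinj u' (hR.mem_toFinset.1 hu') u hu ?_
      rw [← DoubleCoset.doubleCoset_eq_of_mem hgu, DoubleCoset.doubleCoset_eq_of_mem hgu']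
      exact DoubleCoset.mem_doubleCoset_self H H _
    · exact fun h => absurd (hR.mem_toFinset.2 hu) h
  · push Not at hg
    rw [Finset.sum_eq_zero fun u hu =>
      heckeChar_apply_of_notMem hH (hg u (hR.mem_toFinset.1 hu)), mul_zero,
      heckeChar_mul_heckeChar_apply]
    refine Nat.cast_eq_zero.2 ((congrArg Set.ncard (Set.eq_empty_of_forall_notMem ?_)).trans
      (Set.ncard_empty _))
    rintro _ ⟨z, ⟨hz1, hz2⟩, -⟩
    rw [DoubleCoset.mem_doubleCoset] at hz1 hz2
    obtain ⟨a, ha, b, hb, rfl⟩ := hz1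
    obtain ⟨a', ha', b', hb', e⟩ := hz2
    obtain ⟨u, hu, hxu⟩ := hcover (b * a') (H.mul_mem hb ha')
    refine hg u hu ?_
    rw [DoubleCoset.mem_doubleCoset] at hxu ⊢
    obtain ⟨p, hp, r, hr, e'⟩ := hxu
    refine ⟨a * p, H.mul_mem ha hp, r * b', H.mul_mem hr hb', ?_⟩
    have : g = a * (x * (b * a') * y) * b' := by
      rw [← mul_inv_cancel_left (a * x * b) g, e]; group
    rw [this, e']; group

end HeckeProducts

/-! ### Lengths of permutations and minimal coset representatives -/

section Weyl

variable {m : ℕ}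

/-- The inversions of `w`: pairs `a < b` with `w b < w a`. -/
def permInversions (w : Equiv.Perm (Fin m)) : Finset (Fin m × Fin m) :=
  Finset.univ.filter fun p => p.1 < p.2 ∧ w p.2 < w p.1

theorem mem_permInversions {w : Equiv.Perm (Fin m)} {p : Fin m × Fin m} :
    p ∈ permInversions w ↔ p.1 < p.2 ∧ w p.2 < w p.1 := by
  simp [permInversions]

/-- The lower index moved by `s_α`. -/
def SimpleRoot.lo (α : SimpleRoot m) : Fin m := ⟨α.1 - 1, by have := α.2; omega⟩

/-- The upper index moved by `s_α`. -/
def SimpleRoot.hi (α : SimpleRoot m) : Fin m := ⟨α.1, α.2.2⟩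

theorem simpleReflection_eq (α : SimpleRoot m) : simpleReflection α = Equiv.swap α.lo α.hi := rfl

theorem simpleReflection_mul_self (α : SimpleRoot m) :
    simpleReflection α * simpleReflection α = 1 := Equiv.swap_mul_self _ _

theorem SimpleRoot.lo_lt_hi (α : SimpleRoot m) : α.lo < α.hi := by
  have := α.2; simp only [lo, hi, Fin.lt_def]; omega

/-- A simple reflection preserves the order of every pair but the one it swaps. -/
theorem simpleReflection_lt_iff (α : SimpleRoot m) {a b : Fin m} (hab : a < b)
    (hne : (a, b) ≠ (α.lo, α.hi)) : simpleReflection α a < simpleReflection α b := by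
  have h1 := α.2
  rw [simpleReflection_eq, Equiv.swap_apply_def, Equiv.swap_apply_def]
  simp only [SimpleRoot.lo, SimpleRoot.hi, ne_eq, Prod.mk.injEq, not_and, Fin.ext_iff,
    Fin.lt_def] at hab hne ⊢
  split_ifs <;> (try simp only) <;> omega

theorem permInversions_mul_simpleReflection (w : Equiv.Perm (Fin m)) (α : SimpleRoot m)
    (h : w α.lo < w α.hi) :
    (permInversions (w * simpleReflection α)).card = (permInversions w).card + 1 := by
  classical
  have hlo : simpleReflection α α.lo = α.hi := Equiv.swap_apply_left _ _
  have hhi : simpleReflection α α.hi = α.lo := Equiv.swap_apply_right _ _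
  have hs : ∀ a, simpleReflection α (simpleReflection α a) = a := fun a =>
    Equiv.swap_apply_self _ _ _
  have hmem : (α.lo, α.hi) ∈ permInversions (w * simpleReflection α) := by
    rw [mem_permInversions, Equiv.Perm.mul_apply, Equiv.Perm.mul_apply, hlo, hhi]
    exact ⟨α.lo_lt_hi, h⟩
  have hnot : (α.lo, α.hi) ∉ permInversions w := fun hp => lt_asymm h (mem_permInversions.1 hp).2
  rw [← Finset.card_erase_add_one hmem]
  congr 1
  refine Finset.card_bij' (fun p _ => (simpleReflection α p.1, simpleReflection α p.2))
    (fun p _ => (simpleReflection α p.1, simpleReflection α p.2)) ?_ ?_ ?_ ?_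
  · rintro ⟨a, b⟩ hp
    simp only [Finset.mem_erase, mem_permInversions, Equiv.Perm.mul_apply] at hp ⊢
    exact ⟨simpleReflection_lt_iff α hp.2.1 hp.1, hp.2.2⟩
  · rintro ⟨a, b⟩ hp
    have hne : (a, b) ≠ (α.lo, α.hi) := fun e => hnot (e ▸ hp)
    simp only [Finset.mem_erase, mem_permInversions, Equiv.Perm.mul_apply, hs] at hp ⊢
    refine ⟨fun e => ?_, simpleReflection_lt_iff α hp.1 hne, hp.2⟩
    rw [Prod.mk.injEq] at e
    have e1 : a = α.hi := by rw [← hs a, e.1, hlo]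
    have e2 : b = α.lo := by rw [← hs b, e.2, hhi]
    exact absurd hp.1 (by rw [e1, e2]; exact α.lo_lt_hi.le.not_gt)
  · rintro ⟨a, b⟩ _; simp [hs]
  · rintro ⟨a, b⟩ _; simp [hs]

theorem permInversions_mul_simpleReflection_of_gt (w : Equiv.Perm (Fin m)) (α : SimpleRoot m)
    (h : w α.hi < w α.lo) :
    (permInversions w).card = (permInversions (w * simpleReflection α)).card + 1 := by
  have hlo : simpleReflection α α.lo = α.hi := Equiv.swap_apply_left _ _
  have hhi : simpleReflection α α.hi = α.lo := Equiv.swap_apply_right _ _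
  rw [← permInversions_mul_simpleReflection (w * simpleReflection α) α
      (by simpa [hlo, hhi] using h),
    mul_assoc, simpleReflection_mul_self, mul_one]

theorem eq_one_of_forall_lo_lt_hi (w : Equiv.Perm (Fin m))
    (h : ∀ α : SimpleRoot m, w α.lo < w α.hi) : w = 1 := by
  have hmono : StrictMono w := by
    cases m with
    | zero => exact fun a => a.elim0
    | succ n =>
      refine Fin.strictMono_iff_lt_succ.2 fun i => ?_
      exact h ⟨i + 1, by omega, by omega⟩
  have : (hmono.orderIsoOfSurjective w w.surjective) = OrderIso.refl _ := Subsingleton.elim _ _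
  ext i
  exact congrArg Fin.val (congrArg (fun e : Fin m ≃o Fin m => e i) this)

theorem card_permInversions_prod_le (l : List (SimpleRoot m)) :
    (permInversions (l.map simpleReflection).prod).card ≤ l.length := by
  induction l using List.reverseRecOn with
  | nil =>
    refine le_of_eq (Finset.card_eq_zero.2 (Finset.filter_eq_empty_iff.2 fun p _ h => ?_))
    exact lt_asymm h.1 h.2
  | append_singleton l α ih =>
    simp only [List.map_append, List.map_cons, List.map_nil, List.prod_append, List.prod_cons,
      List.prod_nil, mul_one, List.length_append, List.length_cons, List.length_nil]
    set u := (l.map simpleReflection).prod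
    rcases lt_or_gt_of_ne (u.injective.ne α.lo_lt_hi.ne) with h | h
    · rw [permInversions_mul_simpleReflection u α h]; omega
    · have := permInversions_mul_simpleReflection_of_gt u α h; omega

theorem exists_word_card_permInversions (w : Equiv.Perm (Fin m)) :
    ∃ l : List (SimpleRoot m), l.length = (permInversions w).card ∧
      (l.map simpleReflection).prod = w := by
  induction hn : (permInversions w).card generalizing w with
  | zero =>
    refine ⟨[], rfl, (eq_one_of_forall_lo_lt_hi w fun α => ?_).symm⟩
    by_contra hlt
    have hgt := lt_of_le_of_ne (not_lt.1 hlt) (w.injective.ne α.lo_lt_hi.ne')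
    have := permInversions_mul_simpleReflection_of_gt w α hgt
    omega
  | succ n ih =>
    obtain ⟨α, hα⟩ : ∃ α : SimpleRoot m, w α.hi < w α.lo := by
      by_contra! hcon
      have := eq_one_of_forall_lo_lt_hi w fun α =>
        lt_of_le_of_ne (hcon α) (w.injective.ne α.lo_lt_hi.ne)
      subst this
      have := card_permInversions_prod_le ([] : List (SimpleRoot m))
      simp only [List.map_nil, List.prod_nil, List.length_nil] at this
      omega
    have h1 := permInversions_mul_simpleReflection_of_gt w α hα
    obtain ⟨l, hl, hprod⟩ := ih (w * simpleReflection α) (by omega)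
    refine ⟨l ++ [α], by simp [hl], ?_⟩
    simp [hprod, mul_assoc, simpleReflection_mul_self]

/-- The length of a permutation is its number of inversions. -/
theorem weylLength_eq_card_permInversions (w : Equiv.Perm (Fin m)) :
    weylLength w = (permInversions w).card := by
  refine le_antisymm (Nat.sInf_le (exists_word_card_permInversions w)) ?_
  refine le_csInf ⟨_, exists_word_card_permInversions w⟩ ?_
  rintro n ⟨l, rfl, rfl⟩
  exact card_permInversions_prod_le l

/-- A minimal representative modulo the maximal parabolic subgroup at `α` is increasing
on `{1, …, i}` and on `{i + 1, …, m}`. -/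
theorem IsMinimalInCoset.lt_of_lt {α : SimpleRoot m} {w : Equiv.Perm (Fin m)}
    (hw : IsMinimalInCoset {β : SimpleRoot m | β ≠ α} w) {a b : Fin m} (hab : a < b)
    (h : (a : ℕ) < α.1 → (b : ℕ) < α.1) : w a < w b := by
  have step : ∀ β : SimpleRoot m, β ≠ α → w β.lo < w β.hi := by
    intro β hβ
    by_contra hlt
    have hgt := lt_of_le_of_ne (not_lt.1 hlt) (w.injective.ne β.lo_lt_hi.ne')
    have h1 := permInversions_mul_simpleReflection_of_gt w β hgt
    have h2 := hw (simpleReflection β) (Subgroup.subset_closure ⟨β, hβ, rfl⟩)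
    rw [weylLength_eq_card_permInversions, weylLength_eq_card_permInversions] at h2
    omega
  obtain ⟨a, ha⟩ := a
  obtain ⟨b, hb⟩ := b
  simp only [Fin.mk_lt_mk] at hab h
  induction b, hab using Nat.le_induction with
  | base =>
    refine step ⟨a + 1, by omega, hb⟩ fun e => ?_
    have : a + 1 = α.1 := congrArg Subtype.val e
    omega
  | succ b hab ih =>
    refine (ih (by omega) (by omega)).trans (step ⟨b + 1, by omega, hb⟩ fun e => ?_)
    have : b + 1 = α.1 := congrArg Subtype.val e
    omega

/-- `k ∈ A(w, α)`, where `k : Fin m` stands for `k + 1`. -/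
def InA (w : Equiv.Perm (Fin m)) (α : SimpleRoot m) (k : Fin m) : Prop := α.1 ≤ (w⁻¹ k : ℕ)

instance (w : Equiv.Perm (Fin m)) (α : SimpleRoot m) : DecidablePred (InA w α) :=
  fun k => inferInstanceAs (Decidable (α.1 ≤ (w⁻¹ k : ℕ)))

theorem mem_setB {w : Equiv.Perm (Fin m)} {α : SimpleRoot m} {x : ℕ} :
    x ∈ setB w α ↔ ∃ k : Fin m, InA w α k ∧ (k : ℕ) = x := by
  simp only [setB, Finset.mem_image, Finset.mem_filter, Finset.mem_univ, true_and, InA]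
  constructor
  · rintro ⟨j, hj, rfl⟩; exact ⟨w j, by simpa using hj, rfl⟩
  · rintro ⟨k, hk, rfl⟩; exact ⟨w⁻¹ k, hk, by simp⟩

theorem setA_eq_image_setB (w : Equiv.Perm (Fin m)) (α : SimpleRoot m) :
    setA w α = (setB w α).image (· + 1) := by
  rw [setA, setB, Finset.image_image]; rfl

/-- The exponent of `ϖ` in the diagonal entry of `τ_P` at `k`, with `k` counted from `0`: the
factor `τ_x` contributes when `x ≤ k`. -/
def tauExponent (P : Finset ℕ) (k : ℕ) : ℕ := (P.filter (· ≤ k)).card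

theorem tauExponent_mono (P : Finset ℕ) : Monotone (tauExponent P) := fun _ _ h =>
  Finset.card_le_card fun x hx => by
    rw [Finset.mem_filter] at hx ⊢; exact ⟨hx.1, hx.2.trans h⟩

/-- The exponents of `τ_Q` are those of `τ_P` raised by one exactly at the indices in `A`. -/
theorem tauExponent_setQ (w : Equiv.Perm (Fin m)) (α : SimpleRoot m) (k : Fin m) :
    tauExponent (setQ w α) k = tauExponent (setP w α) k + if InA w α k then 1 else 0 := by
  classical
  set A := (setA w α).filter (· ≤ (k : ℕ)) with hA
  set B := (setB w α).filter (· ≤ (k : ℕ)) with hB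
  have hQ : (setQ w α).filter (· ≤ (k : ℕ)) = B \ A := by
    ext x
    simp only [setQ, hA, hB, Finset.mem_filter, Finset.mem_sdiff]
    tauto
  have hP : (setP w α).filter (· ≤ (k : ℕ)) = A \ B := by
    ext x
    simp only [setP, hA, hB, Finset.mem_filter, Finset.mem_sdiff]
    have h1 : x ∈ setA w α → 1 ≤ x := by
      rw [setA_eq_image_setB, Finset.mem_image]; rintro ⟨y, _, rfl⟩; omega
    have h2 := k.2
    constructor
    · tauto
    · rintro ⟨⟨h3, h4⟩, h5⟩
      exact ⟨⟨⟨h3, fun h => h5 ⟨h, h4⟩⟩, h1 h3, by omega⟩, h4⟩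
  have hA' : A.card = ((setB w α).filter (· < (k : ℕ))).card := by
    rw [hA, setA_eq_image_setB, Finset.filter_image,
      Finset.card_image_of_injective _ (add_left_injective 1)]
    congr 1
  have hB' : B.card = ((setB w α).filter (· < (k : ℕ))).card + if InA w α k then 1 else 0 := by
    have hk : (k : ℕ) ∈ setB w α ↔ InA w α k := by
      rw [mem_setB]
      exact ⟨fun ⟨j, hj, e⟩ => Fin.ext e ▸ hj, fun h => ⟨k, h, rfl⟩⟩
    split_ifs with h
    · rw [← Finset.card_insert_of_notMem (a := (k : ℕ)) (by simp)]
      congr 1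
      ext x
      simp only [hB, Finset.mem_filter, Finset.mem_insert]
      constructor
      · rintro ⟨h1, h2⟩
        rcases h2.eq_or_lt with h3 | h3
        exacts [Or.inl h3, Or.inr ⟨h1, h3⟩]
      · rintro (rfl | ⟨h1, h2⟩)
        exacts [⟨hk.2 h, le_rfl⟩, ⟨h1, h2.le⟩]
    · rw [add_zero]
      congr 1
      ext x
      simp only [hB, Finset.mem_filter]
      refine and_congr_right fun hx => ⟨fun h2 => lt_of_le_of_ne h2 ?_, le_of_lt⟩
      rintro rfl
      exact h (hk.1 hx)
  have h1 := Finset.card_sdiff_add_card_inter B A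
  have h2 := Finset.card_sdiff_add_card_inter A B
  rw [Finset.inter_comm] at h2
  rw [tauExponent, tauExponent, hQ, hP]
  omega

/-- The exponents of `τ_P` jump strictly between an index in `A` and a later one outside `A`. -/
theorem tauExponent_setP_lt (w : Equiv.Perm (Fin m)) (α : SimpleRoot m) {k h : Fin m}
    (hkh : k < h) (hk : InA w α k) (hh : ¬ InA w α h) :
    tauExponent (setP w α) k < tauExponent (setP w α) h := by
  classical
  have hB : ∀ j : Fin m, (j : ℕ) ∈ setB w α ↔ InA w α j := fun j => by
    rw [mem_setB]
    exact ⟨fun ⟨i, hi, e⟩ => Fin.ext e ▸ hi, fun h => ⟨j, h, rfl⟩⟩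
  have hex : ∃ x : ℕ, (k : ℕ) < x ∧ x ∉ setB w α := ⟨h, hkh, fun e => hh ((hB h).1 e)⟩
  obtain ⟨hx1, hx2⟩ := Nat.find_spec hex
  set x := Nat.find hex with hx
  have hxh : x ≤ h := Nat.find_min' hex ⟨hkh, fun e => hh ((hB h).1 e)⟩
  have hx3 : x - 1 ∈ setB w α := by
    by_contra hcon
    rcases Nat.lt_or_ge k (x - 1) with h1 | h1
    · exact Nat.find_min hex (m := x - 1) (by omega) ⟨h1, hcon⟩
    · rw [show x - 1 = k by omega] at hcon
      exact hcon ((hB k).2 hk)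
  have hxP : x ∈ setP w α := by
    rw [setP, Finset.mem_filter, Finset.mem_sdiff, setA_eq_image_setB, Finset.mem_image]
    exact ⟨⟨⟨x - 1, hx3, by omega⟩, hx2⟩, by omega, by have := h.2; omega⟩
  refine Finset.card_lt_card (Finset.ssubset_iff_subset_ne.2 ⟨fun y hy => ?_, fun e => ?_⟩)
  · rw [Finset.mem_filter] at hy ⊢; exact ⟨hy.1, hy.2.trans hkh.le⟩
  · have : x ∈ (setP w α).filter (· ≤ (k : ℕ)) := by
      rw [e, Finset.mem_filter]; exact ⟨hxP, hxh⟩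
    rw [Finset.mem_filter] at this
    omega

/-- The positions `(h, k)` with `k < h`, `h ∉ A`, `k ∈ A`. -/
abbrev LowPosition (w : Equiv.Perm (Fin m)) (α : SimpleRoot m) : Type :=
  {p : Fin m × Fin m // p.2 < p.1 ∧ ¬ InA w α p.1 ∧ InA w α p.2}

theorem card_lowPosition {α : SimpleRoot m} {w : Equiv.Perm (Fin m)}
    (hw : IsMinimalInCoset {β : SimpleRoot m | β ≠ α} w) :
    Nat.card (LowPosition w α) = weylLength w := by
  rw [weylLength_eq_card_permInversions, ← Nat.card_eq_finsetCard]
  refine (Nat.card_congr (Equiv.ofBijective (fun p : permInversions w =>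
    (⟨(w p.1.1, w p.1.2), ?_⟩ : LowPosition w α)) ⟨?_, ?_⟩)).symm
  · obtain ⟨⟨a, b⟩, hp⟩ := p
    rw [mem_permInversions] at hp
    have h : ¬ ((a : ℕ) < α.1 → (b : ℕ) < α.1) := fun h => lt_asymm hp.2 (hw.lt_of_lt hp.1 h)
    have hinv : ∀ x, w⁻¹ (w x) = x := w.symm_apply_apply
    simp only [InA, hinv]
    exact ⟨hp.2, by omega, by omega⟩
  · rintro ⟨⟨a, b⟩, hp⟩ ⟨⟨a', b'⟩, hp'⟩ e
    simpa using e
  · rintro ⟨⟨h, k⟩, hp⟩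
    refine ⟨⟨(w⁻¹ h, w⁻¹ k), ?_⟩, by simp⟩
    rw [mem_permInversions]
    simp only [InA] at hp
    have hinv : ∀ x, w (w⁻¹ x) = x := w.apply_symm_apply
    simp only [hinv, Fin.lt_def]
    exact ⟨by omega, hp.1⟩

end Weyl

/-! ### Compactness of the maximal order and the Hecke pair property -/

section Finiteness

variable (F : Type*) [Field F] [ValuativeRel F] [TopologicalSpace F] [IsNonarchimedeanLocalField F]

theorem exists_finite_residue_representatives :
    ∃ T : Set F, T.Finite ∧ ∀ c, valuation F c ≤ 1 →
      ∃ t ∈ T, valuation F (c - t) < 1 := by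
  let f : 𝓀[F] → 𝒪[F] := Function.surjInv IsLocalRing.residue_surjective
  refine ⟨Set.range fun a => (f a : F), Set.finite_range _, fun c hc => ?_⟩
  let c' : 𝒪[F] := ⟨c, hc⟩
  refine ⟨_, ⟨IsLocalRing.residue _ c', rfl⟩, ?_⟩
  have h : c' - f (IsLocalRing.residue _ c') ∈ 𝓂[F] := by
    rw [← IsLocalRing.residue_eq_zero_iff, map_sub,
      Function.surjInv_eq IsLocalRing.residue_surjective, sub_self]
  refine lt_of_le_of_ne (c' - f (IsLocalRing.residue _ c')).2 fun e =>
    (IsLocalRing.mem_maximalIdeal _).1 h ?_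
  exact (Valuation.integer.integers (valuation F)).isUnit_iff_valuation_eq_one.2 e

variable (D : Type*) [DivisionRing D] [Algebra F D] [FiniteDimensional F D]

theorem divisionValuation_smul (c : F) (x : D) :
    divisionValuation F D (c • x) =
      valuation F c ^ Module.finrank F D * divisionValuation F D x := by
  rw [Algebra.smul_def, map_mul]
  congr 1
  change valuation F (Algebra.norm F (algebraMap F D c)) = _
  rw [Algebra.norm_algebraMap, map_pow]

variable {D} in
/-- The finite set `s ⊆ 𝒪_D` is linearly independent modulo `π 𝒪_D` over the residue field of `F`;
the condition is phrased with coefficients in the ring of integers of `F`. -/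
def IndepMod (π : F) (s : Finset D) : Prop :=
  (∀ x ∈ s, divisionValuation F D x ≤ 1) ∧ ∀ c : D → F, (∀ x ∈ s, valuation F (c x) ≤ 1) →
    divisionValuation F D (∑ x ∈ s, c x • x) ≤ valuation F π ^ Module.finrank F D →
      ∀ x ∈ s, valuation F (c x) < 1

variable {F D} in
/-- Independence modulo `π` lifts to independence over `F`: divide a relation by its largest
coefficient. -/
theorem IndepMod.card_le {π : F} {s : Finset D} (hs : IndepMod F π s) :
    s.card ≤ Module.finrank F D := by
  classical
  apply LinearIndependent.finset_card_le_finrank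
  refine (linearIndepOn_finset_iff (R := F) (v := (id : D → D))).2 fun c hc => ?_
  by_contra! hne
  obtain ⟨x₀, hx₀, hcx₀⟩ := hne
  obtain ⟨x₁, hx₁, hmax⟩ := s.exists_max_image (fun x => valuation F (c x)) ⟨x₀, hx₀⟩
  have hpos : 0 < valuation F (c x₁) :=
    (zero_lt_iff.2 ((Valuation.ne_zero_iff _).2 hcx₀)).trans_le (hmax x₀ hx₀)
  have hc1 : c x₁ ≠ 0 := (Valuation.ne_zero_iff _).1 hpos.ne'
  have := hs.2 (fun x => (c x₁)⁻¹ * c x) (fun x hx => ?_) ?_ x₁ hx₁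
  · simp [inv_mul_cancel₀ hc1] at this
  · rw [map_mul, map_inv₀, mul_comm]
    exact mul_inv_le_one_of_le₀ (hmax x hx) zero_le
  · simp only [id] at hc
    simp only [mul_smul]
    rw [← Finset.smul_sum, hc, smul_zero, map_zero]
    exact zero_le

/-- `𝒪_D / π 𝒪_D` is finite for a uniformizer `π` of `F`: a maximal independent subset spans it
over the finite residue field of `F`. -/
theorem exists_finite_cover_uniformizer :
    ∃ π : F, valuation F π ≠ 0 ∧ valuation F π < 1 ∧ ∃ S : Set D, S.Finite ∧
      ∀ x, divisionValuation F D x ≤ 1 → ∃ s ∈ S,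
        divisionValuation F D (x - s) ≤ valuation F π ^ Module.finrank F D := by
  classical
  obtain ⟨π, hπ⟩ := valuation_surjective (ValuativeRel.uniformizer F)
  have hπ0 : valuation F π ≠ 0 := hπ ▸ uniformizer_ne_zero
  have hπle : ∀ c : F, valuation F c < 1 → valuation F c ≤ valuation F π := fun c hc =>
    hπ ▸ le_uniformizer_iff.2 hc
  have hsmul : ∀ (c : F) (x : D), valuation F c < 1 → divisionValuation F D x ≤ 1 →
      divisionValuation F D (c • x) ≤ valuation F π ^ Module.finrank F D := fun c x hc hx => by
    rw [divisionValuation_smul]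
    exact (mul_le_of_le_one_right' hx).trans (pow_le_pow_left₀ zero_le (hπle c hc) _)
  refine ⟨π, hπ0, hπ ▸ uniformizer_lt_one, ?_⟩
  obtain ⟨T, hT, hTc⟩ := exists_finite_residue_representatives F
  obtain ⟨s, hs, hmax⟩ : ∃ s : Finset D, IndepMod F π s ∧
      ∀ s', IndepMod F π s' → s'.card ≤ s.card := by
    have hbdd : BddAbove {n | ∃ s : Finset D, IndepMod F π s ∧ s.card = n} :=
      ⟨Module.finrank F D, by rintro _ ⟨s, hs, rfl⟩; exact hs.card_le⟩
    obtain ⟨s, hs, hcard⟩ := Nat.sSup_mem (s := {n | ∃ s : Finset D, IndepMod F π s ∧ s.card = n})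
      ⟨0, ∅, ⟨by simp, by simp⟩, rfl⟩ hbdd
    exact ⟨s, hs, fun s' hs' => hcard ▸ le_csSup hbdd ⟨s', hs', rfl⟩⟩
  have := hT.to_subtype
  refine ⟨Set.range fun f : s → T => ∑ y : s, (f y : F) • (y : D), Set.finite_range _, ?_⟩
  intro x hx
  obtain ⟨d, hd, hxd⟩ : ∃ d : D → F, (∀ y ∈ s, valuation F (d y) ≤ 1) ∧
      divisionValuation F D (x - ∑ y ∈ s, d y • y) ≤ valuation F π ^ Module.finrank F D := by
    by_cases hxs : x ∈ s
    · refine ⟨fun y => if y = x then 1 else 0, fun y _ => by dsimp only; split_ifs <;> simp, ?_⟩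
      simp [hxs]
    have hnot : ¬ IndepMod F π (insert x s) := fun h => by
      have := hmax _ h
      rw [Finset.card_insert_of_notMem hxs] at this
      omega
    rw [IndepMod, not_and_or] at hnot
    rcases hnot with hnot | hnot
    · exact absurd (fun y hy => (Finset.mem_insert.1 hy).elim (fun e => e ▸ hx) (hs.1 y)) hnot
    push Not at hnot
    obtain ⟨c, hc1, hc2, z, hz, hcz⟩ := hnot
    rw [Finset.sum_insert hxs] at hc2
    have hcx : ¬ valuation F (c x) < 1 := by
      intro hlt
      have hsum := (divisionValuation F D).map_sub_le hc2 (hsmul (c x) x hlt hx)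
      rw [add_sub_cancel_left] at hsum
      have h1 := hs.2 c (fun y hy => hc1 y (Finset.mem_insert_of_mem hy)) hsum
      rcases Finset.mem_insert.1 hz with rfl | hz
      · exact hcz.not_gt hlt
      · exact hcz.not_gt (h1 z hz)
    have hcx1 : valuation F (c x) = 1 :=
      le_antisymm (hc1 x (Finset.mem_insert_self _ _)) (not_lt.1 hcx)
    have hcx0 : c x ≠ 0 := fun h => by simp [h] at hcx1
    refine ⟨fun y => -((c x)⁻¹ * c y), fun y hy => ?_, ?_⟩
    · rw [Valuation.map_neg, map_mul, map_inv₀, hcx1, inv_one, one_mul]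
      exact hc1 y (Finset.mem_insert_of_mem hy)
    · have : x - ∑ y ∈ s, (-((c x)⁻¹ * c y)) • y = (c x)⁻¹ • (c x • x + ∑ y ∈ s, c y • y) := by
        rw [smul_add, smul_smul, inv_mul_cancel₀ hcx0, one_smul, Finset.smul_sum, sub_eq_add_neg,
          ← Finset.sum_neg_distrib]
        congr 1
        exact Finset.sum_congr rfl fun y _ => by rw [neg_smul, neg_neg, mul_smul]
      rw [this, divisionValuation_smul, map_inv₀, hcx1, inv_one, one_pow, one_mul]
      exact hc2
  choose! t htT ht using hTc
  refine ⟨_, ⟨fun y => ⟨t (d y), htT _ (hd y y.2)⟩, rfl⟩, ?_⟩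
  dsimp only
  rw [Finset.sum_coe_sort s (fun y => t (d y) • y)]
  have : x - ∑ y ∈ s, t (d y) • y =
      (x - ∑ y ∈ s, d y • y) + ∑ y ∈ s, (d y - t (d y)) • y := by
    simp only [sub_smul, Finset.sum_sub_distrib]; abel
  rw [this]
  refine (divisionValuation F D).map_add_le hxd ((divisionValuation F D).map_sum_le fun y hy => ?_)
  exact hsmul _ y (ht _ (hd y hy)) (hs.1 y hy)

/-- The maximal order is totally bounded. -/
theorem exists_finite_cover {γ : ValueGroupWithZero F} (hγ : γ ≠ 0) :
    ∃ S : Set D, S.Finite ∧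
      ∀ x, divisionValuation F D x ≤ 1 → ∃ s ∈ S, divisionValuation F D (x - s) ≤ γ := by
  obtain ⟨π, hπ0, hπ1, S, hS, hcover⟩ := exists_finite_cover_uniformizer F D
  set ε := valuation F π ^ Module.finrank F D with hε
  have hε0 : ε ≠ 0 := pow_ne_zero _ hπ0
  have hε1 : ε < 1 := pow_lt_one₀ zero_le hπ1 Module.finrank_pos.ne'
  have hπF : π ≠ 0 := (Valuation.ne_zero_iff _).1 hπ0
  have : MulArchimedean (ValueGroupWithZero F) :=
    isRankLeOne_iff_mulArchimedean.1 inferInstance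
  obtain ⟨N, hN⟩ := exists_pow_lt₀ hε1 (Units.mk0 γ hγ)
  suffices h : ∀ N : ℕ, ∃ S : Set D, S.Finite ∧
      ∀ x, divisionValuation F D x ≤ 1 → ∃ s ∈ S, divisionValuation F D (x - s) ≤ ε ^ N by
    obtain ⟨S, hS, hc⟩ := h N
    exact ⟨S, hS, fun x hx => (hc x hx).imp fun s hs => ⟨hs.1, hs.2.trans hN.le⟩⟩
  intro N
  induction N with
  | zero => exact ⟨{0}, Set.finite_singleton _, fun x hx => ⟨0, rfl, by simpa using hx⟩⟩
  | succ N ih =>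
    obtain ⟨S', hS', hc'⟩ := ih
    refine ⟨Set.image2 (fun a b => a + π ^ N • b) S' S, hS'.image2 _ hS, fun x hx => ?_⟩
    obtain ⟨a, ha, hxa⟩ := hc' x hx
    have hval : ∀ y : D, divisionValuation F D (π ^ N • y) = ε ^ N * divisionValuation F D y := by
      intro y
      rw [divisionValuation_smul, map_pow, hε, ← pow_mul, ← pow_mul, mul_comm N]
    have hy : x - a = π ^ N • ((π ^ N)⁻¹ • (x - a)) := by
      rw [smul_smul, mul_inv_cancel₀ (pow_ne_zero _ hπF), one_smul]
    have hy1 : divisionValuation F D ((π ^ N)⁻¹ • (x - a)) ≤ 1 := by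
      rw [hy, hval] at hxa
      exact le_of_mul_le_mul_left (by rwa [mul_one]) (pow_pos (zero_lt_iff.2 hε0) N)
    obtain ⟨b, hb, hyb⟩ := hcover _ hy1
    refine ⟨_, ⟨a, ha, b, hb, rfl⟩, ?_⟩
    rw [← sub_sub, hy, ← smul_sub, hval, pow_succ]
    exact mul_le_mul_right hyb _

variable {m : ℕ}

/-- A map on matrices with integral entries that is constant on small balls has finite image. -/
theorem finite_image_of_close {γ : ValueGroupWithZero F} (hγ : γ ≠ 0) {C : Type*}
    {X : Set (GL (Fin m) D)} (p : GL (Fin m) D → C)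
    (hX : ∀ g ∈ X, ∀ i j, divisionValuation F D ((g : Matrix (Fin m) (Fin m) D) i j) ≤ 1)
    (hp : ∀ g ∈ X, ∀ g' ∈ X, (∀ i j, divisionValuation F D
      ((g : Matrix (Fin m) (Fin m) D) i j - (g' : Matrix (Fin m) (Fin m) D) i j) ≤ γ) →
        p g = p g') : (p '' X).Finite := by
  obtain ⟨S, hS, hcover⟩ := exists_finite_cover F D hγ
  choose! a haS ha using hcover
  let f : GL (Fin m) D → Fin m → Fin m → D := fun g i j => a ((g : Matrix (Fin m) (Fin m) D) i j)
  have hf : (f '' X).Finite := by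
    refine (Set.Finite.pi' (fun _ => Set.Finite.pi' (fun _ => hS))).subset ?_
    rintro _ ⟨g, hg, rfl⟩ i j
    exact haS _ (hX g hg i j)
  obtain ⟨X', hX', hbij⟩ := Set.exists_subset_bijOn X f
  refine ((hbij.finite_iff_finite.2 hf).image p).subset ?_
  rintro _ ⟨g, hg, rfl⟩
  obtain ⟨g', hg', e⟩ := hbij.surjOn ⟨g, hg, rfl⟩
  refine ⟨g', hg', hp g' (hX' hg') g hg fun i j => ?_⟩
  have e' : a ((g' : Matrix (Fin m) (Fin m) D) i j) = a ((g : Matrix (Fin m) (Fin m) D) i j) :=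
    congrFun (congrFun e i) j
  have h1 := ha _ (hX g' (hX' hg') i j)
  have h2 := ha _ (hX g hg i j)
  rw [e'] at h1
  simpa using (divisionValuation F D).map_sub_le h1 h2

theorem mem_congruenceSubgroup {g : GL (Fin m) D} : g ∈ congruenceSubgroup F D m ↔
    ∀ i j, divisionValuation F D
      (((g : Matrix (Fin m) (Fin m) D) - 1) i j) < 1 := Iff.rfl

theorem congruenceSubgroup_le_one {g : GL (Fin m) D} (hg : g ∈ congruenceSubgroup F D m)
    (i j : Fin m) : divisionValuation F D ((g : Matrix (Fin m) (Fin m) D) i j) ≤ 1 := by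
  have h := (divisionValuation F D).map_add_le (hg i j).le
    (show divisionValuation F D ((1 : Matrix (Fin m) (Fin m) D) i j) ≤ 1 by
      rw [Matrix.one_apply]; split_ifs <;> simp)
  simpa using h

theorem isHeckePair_congruenceSubgroup : IsHeckePair (congruenceSubgroup F D m) := by
  intro g
  set v := divisionValuation F D
  -- `C` bounds the effect of conjugation by `g` on the entries
  obtain ⟨C, hC0, hC⟩ : ∃ C : ValueGroupWithZero F, C ≠ 0 ∧ ∀ i j k l,
      v (((g⁻¹ : GL (Fin m) D) : Matrix (Fin m) (Fin m) D) i j) *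
        v ((g : Matrix (Fin m) (Fin m) D) k l) ≤ C := by
    let s : Finset (ValueGroupWithZero F) :=
      insert 1 (Finset.univ.image fun q : (Fin m × Fin m) × (Fin m × Fin m) =>
        v (((g⁻¹ : GL (Fin m) D) : Matrix (Fin m) (Fin m) D) q.1.1 q.1.2) *
        v ((g : Matrix (Fin m) (Fin m) D) q.2.1 q.2.2))
    have hs : s.Nonempty := ⟨1, Finset.mem_insert_self _ _⟩
    refine ⟨s.max' hs, (zero_lt_one.trans_le (s.le_max' 1 (Finset.mem_insert_self _ _))).ne',
      fun i j k l => s.le_max' _ (Finset.mem_insert_of_mem (Finset.mem_image.2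
        ⟨((i, j), (k, l)), Finset.mem_univ _, rfl⟩))⟩
  obtain ⟨δ, hδ0, hδ1⟩ := IsNontrivial.exists_lt_one (R := F)
  have hγ : δ * C⁻¹ ≠ 0 := mul_ne_zero hδ0.ne' (inv_ne_zero hC0)
  refine (finite_image_of_close F D hγ (X := congruenceSubgroup F D m)
    (fun h => (QuotientGroup.mk (h * g) : GL (Fin m) D ⧸ congruenceSubgroup F D m))
    (fun h hh i j => congruenceSubgroup_le_one F D hh i j) ?_).subset ?_
  · intro h hh h' hh' hclose
    refine QuotientGroup.eq.2 ((mem_congruenceSubgroup F D).2 fun i j => ?_)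
    have e : (((h * g)⁻¹ * (h' * g) : GL (Fin m) D) : Matrix (Fin m) (Fin m) D) - 1 =
        ((g⁻¹ : GL (Fin m) D) : Matrix (Fin m) (Fin m) D) *
          (((h⁻¹ : GL (Fin m) D) : Matrix (Fin m) (Fin m) D) *
            ((h' : Matrix (Fin m) (Fin m) D) - (h : Matrix (Fin m) (Fin m) D))) *
          (g : Matrix (Fin m) (Fin m) D) := by
      rw [mul_sub, ← Units.val_mul, ← Units.val_mul, inv_mul_cancel, mul_sub, sub_mul,
        ← Units.val_mul, ← Units.val_mul, Units.val_one, mul_one, ← Units.val_mul, inv_mul_cancel,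
        Units.val_one]
      congr 2; group
    rw [e, Matrix.mul_apply]
    refine (v.map_sum_le fun k _ => ?_).trans_lt hδ1
    rw [Matrix.mul_apply, Finset.sum_mul]
    refine v.map_sum_le fun l _ => ?_
    have h1 : v ((((h⁻¹ : GL (Fin m) D) : Matrix (Fin m) (Fin m) D) *
        ((h' : Matrix (Fin m) (Fin m) D) - (h : Matrix (Fin m) (Fin m) D))) l k) ≤ δ * C⁻¹ := by
      rw [Matrix.mul_apply]
      refine v.map_sum_le fun r _ => ?_
      rw [map_mul, Matrix.sub_apply, v.map_sub_swap]
      exact (mul_le_of_le_one_left' (congruenceSubgroup_le_one F D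
        ((congruenceSubgroup F D m).inv_mem hh) l r)).trans (hclose r k)
    rw [map_mul, map_mul, mul_right_comm]
    refine (mul_le_mul' (hC i l k j) h1).trans (le_of_eq ?_)
    rw [mul_comm δ, mul_inv_cancel_left₀ hC0]
  · rintro _ ⟨x, hx, rfl⟩
    obtain ⟨h, hh, h', hh', rfl⟩ := DoubleCoset.mem_doubleCoset.1 hx
    refine ⟨h, hh, QuotientGroup.eq.2 ?_⟩
    simpa [mul_assoc] using hh'

end Finiteness

/-! ### Diagonal and unipotent matrices -/

section Matrices

variable {D : Type*} [DivisionRing D] {m : ℕ}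

/-- The diagonal matrix with entries `ϖ ^ e k`. -/
def tauPow (ϖ : Dˣ) (e : Fin m → ℕ) : GL (Fin m) D where
  val := Matrix.diagonal fun k => ((ϖ ^ e k : Dˣ) : D)
  inv := Matrix.diagonal fun k => (((ϖ ^ e k)⁻¹ : Dˣ) : D)
  val_inv := by simp [Matrix.diagonal_mul_diagonal, -Units.val_pow_eq_pow_val]
  inv_val := by simp [Matrix.diagonal_mul_diagonal, -Units.val_pow_eq_pow_val]

theorem tauPow_mul (ϖ : Dˣ) (e e' : Fin m → ℕ) :
    tauPow ϖ e * tauPow ϖ e' = tauPow ϖ (fun k => e k + e' k) := by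
  apply Units.ext
  change Matrix.diagonal _ * Matrix.diagonal _ = Matrix.diagonal _
  rw [Matrix.diagonal_mul_diagonal]
  simp [pow_add]

theorem tau_eq_tauPow (ϖ : Dˣ) (i : ℕ) :
    tau m ϖ i = tauPow ϖ (fun k => if i ≤ (k : ℕ) then 1 else 0) := by
  apply Units.ext
  change Matrix.diagonal _ = Matrix.diagonal _
  congr 1; ext k
  by_cases h : (k : ℕ) < i
  · simp [h, not_le.2 h]
  · simp [h, not_lt.1 h]

theorem tauSet_eq_tauPow (ϖ : Dˣ) (P : Finset ℕ) :
    tauSet m ϖ P = tauPow ϖ (fun k => tauExponent P k) := by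
  classical
  induction P using Finset.induction_on with
  | empty =>
    apply Units.ext
    change (1 : Matrix (Fin m) (Fin m) D) = Matrix.diagonal _
    simp [tauExponent]
  | insert a s ha ih =>
    rw [tauSet, Finset.noncommProd_insert_of_notMem _ _ _ _ ha]
    change tau m ϖ a * tauSet m ϖ s = _
    rw [ih, tau_eq_tauPow, tauPow_mul]
    congr 1; ext k
    simp only [tauExponent, Finset.filter_insert]
    split_ifs with h
    · rw [Finset.card_insert_of_notMem (by simp [ha]), add_comm]
    · rw [zero_add]

theorem weylMatrix_conj_apply (w : Equiv.Perm (Fin m)) (g : GL (Fin m) D) (h k : Fin m) :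
    ((weylMatrix D w * g * (weylMatrix D w)⁻¹ : GL (Fin m) D) : Matrix (Fin m) (Fin m) D) h k =
      (g : Matrix (Fin m) (Fin m) D) (w⁻¹ h) (w⁻¹ k) := by
  have hw : ∀ i, h = w i ↔ i = w⁻¹ h := fun i =>
    ⟨fun e => by rw [e]; exact (w.symm_apply_apply i).symm,
      fun e => by rw [e]; exact (w.apply_symm_apply h).symm⟩
  rw [← map_inv]
  simp only [Units.val_mul, Matrix.mul_apply, weylMatrix, MonoidHom.coe_mk, OneHom.coe_mk,
    Matrix.of_apply, hw]
  simp

theorem weylMatrix_conj_tau (w : Equiv.Perm (Fin m)) (α : SimpleRoot m) (ϖ : Dˣ) :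
    weylMatrix D w * tau m ϖ α.1 * (weylMatrix D w)⁻¹ =
      tauPow ϖ (fun k => if InA w α k then 1 else 0) := by
  ext h k
  rw [weylMatrix_conj_apply, tau_eq_tauPow]
  change Matrix.diagonal _ _ _ = Matrix.diagonal _ _ _
  simp only [Matrix.diagonal_apply, EmbeddingLike.apply_eq_iff_eq, InA]
  congr

/-- The unipotent matrix `1 + N` with `N ^ 2 = 0`. -/
def unipOfSqZero (N : Matrix (Fin m) (Fin m) D) (hN : N * N = 0) : GL (Fin m) D where
  val := 1 + N
  inv := 1 - N
  val_inv := by noncomm_ring; rw [hN, smul_zero, add_zero]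
  inv_val := by noncomm_ring; rw [hN, smul_zero, add_zero]

theorem unipOfSqZero_val (N : Matrix (Fin m) (Fin m) D) (hN : N * N = 0) :
    (unipOfSqZero N hN : Matrix (Fin m) (Fin m) D) = 1 + N := rfl

/-- Two matrices supported on the block `X × Xᶜ` have product zero. -/
theorem mul_eq_zero_of_block (X : Fin m → Prop) {N N' : Matrix (Fin m) (Fin m) D}
    (hN : ∀ h k, N h k ≠ 0 → ¬ X k) (hN' : ∀ h k, N' h k ≠ 0 → X h) : N * N' = 0 := by
  ext h k
  rw [Matrix.mul_apply, Matrix.zero_apply]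
  refine Finset.sum_eq_zero fun l _ => ?_
  by_contra hne
  exact hN h l (left_ne_zero_of_mul hne) (hN' l k (right_ne_zero_of_mul hne))

end Matrices

/-- Scaling by `ϖ ^ (a - b)` with `b ≤ a` preserves `℘_D`. -/
theorem pow_mul_lt_one {Γ : Type*} [LinearOrderedCommGroupWithZero Γ] {p x : Γ}
    (hp0 : p ≠ 0) (hp1 : p < 1) (hx : x < 1) {a b : ℕ} (hab : b ≤ a) :
    p ^ a * x * (p ^ b)⁻¹ < 1 := by
  obtain ⟨c, rfl⟩ := Nat.exists_eq_add_of_le hab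
  have : p ^ (b + c) * x * (p ^ b)⁻¹ = p ^ c * x := by
    rw [pow_add, mul_comm, ← mul_assoc, ← mul_assoc, inv_mul_cancel₀ (pow_ne_zero _ hp0), one_mul]
  rw [this]
  exact mul_lt_one_of_nonneg_of_lt_one_right (pow_le_one₀ zero_le hp1.le) zero_le hx

/-- Scaling by a positive power of `ϖ` maps `𝒪_D` into `℘_D`. -/
theorem pow_mul_lt_one' {Γ : Type*} [LinearOrderedCommGroupWithZero Γ] {p x : Γ}
    (hp0 : p ≠ 0) (hp1 : p < 1) (hx : x ≤ 1) {a b : ℕ} (hab : b < a) :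
    p ^ a * x * (p ^ b)⁻¹ < 1 := by
  have : p ^ a * x * (p ^ b)⁻¹ = p ^ (a - 1) * (p * x) * (p ^ b)⁻¹ := by
    rw [← mul_assoc (p ^ (a - 1)), ← pow_succ, Nat.sub_add_cancel (by omega)]
  rw [this]
  refine pow_mul_lt_one hp0 hp1 ?_ (by omega)
  rw [mul_comm]
  exact mul_lt_one_of_nonneg_of_lt_one_right hx zero_le hp1

section Integral

variable (F : Type*) [Field F] [ValuativeRel F] [TopologicalSpace F] [IsNonarchimedeanLocalField F]
  {D : Type*} [DivisionRing D] [Algebra F D] [FiniteDimensional F D] {m : ℕ}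

variable {F} in
theorem IsDivisionUniformizer.lt_one_iff {ϖ : Dˣ} (hϖ : IsDivisionUniformizer F ϖ) (x : D) :
    divisionValuation F D x < 1 ↔ divisionValuation F D x ≤ divisionValuation F D ϖ := by
  have hv : divisionValuation F D ϖ ≠ 0 := (Valuation.ne_zero_iff _).2 ϖ.ne_zero
  constructor
  · intro hx
    have : x ∈ Subtype.val '' (integerPrime F D : Set (integerRing F D)) := ⟨⟨x, hx.le⟩, hx, rfl⟩
    rw [hϖ] at this
    obtain ⟨y, hy, rfl⟩ := this
    dsimp only
    rw [map_mul]
    exact mul_le_of_le_one_right' hy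
  · intro hx
    have : x ∈ (fun y : D => (ϖ : D) * y) '' (integerRing F D : Set D) := by
      refine ⟨(ϖ⁻¹ : Dˣ) * x, ?_, by simp⟩
      change divisionValuation F D _ ≤ 1
      rw [map_mul, Units.val_inv_eq_inv_val, map_inv₀, mul_comm]
      exact mul_inv_le_one_of_le₀ hx zero_le
    rw [← hϖ] at this
    obtain ⟨y, hy, rfl⟩ := this
    exact hy

variable {F} in
theorem IsDivisionUniformizer.lt_one {ϖ : Dˣ} (hϖ : IsDivisionUniformizer F ϖ) :
    divisionValuation F D ϖ < 1 := (hϖ.lt_one_iff _).2 le_rfl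

theorem divisionValuation_one_apply_le (i j : Fin m) :
    divisionValuation F D ((1 : Matrix (Fin m) (Fin m) D) i j) ≤ 1 := by
  rw [Matrix.one_apply]; split_ifs <;> simp

theorem divisionValuation_mul_apply_lt {A B : Matrix (Fin m) (Fin m) D}
    (hA : ∀ i j, divisionValuation F D (A i j) ≤ 1)
    (hB : ∀ i j, divisionValuation F D (B i j) < 1) (i j : Fin m) :
    divisionValuation F D ((A * B) i j) < 1 := by
  rw [Matrix.mul_apply]
  refine Valuation.map_sum_lt' _ zero_lt_one fun k _ => ?_
  rw [map_mul]
  exact mul_lt_one_of_nonneg_of_lt_one_right (hA i k) zero_le (hB k j)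

theorem divisionValuation_mul_apply_lt' {A B : Matrix (Fin m) (Fin m) D}
    (hA : ∀ i j, divisionValuation F D (A i j) < 1)
    (hB : ∀ i j, divisionValuation F D (B i j) ≤ 1) (i j : Fin m) :
    divisionValuation F D ((A * B) i j) < 1 := by
  rw [Matrix.mul_apply]
  refine Valuation.map_sum_lt' _ zero_lt_one fun k _ => ?_
  rw [map_mul, mul_comm]
  exact mul_lt_one_of_nonneg_of_lt_one_right (hB k j) zero_le (hA i k)

/-- `K` normalizes `K¹`. -/
theorem maxCompact_le_normalizer {u : GL (Fin m) D} (hu : u ∈ maxCompact F D m) :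
    u ∈ Subgroup.normalizer (congruenceSubgroup F D m : Set (GL (Fin m) D)) := by
  have key : ∀ u ∈ maxCompact F D m, ∀ h ∈ congruenceSubgroup F D m,
      u * h * u⁻¹ ∈ congruenceSubgroup F D m := by
    intro u hu h hh
    rw [mem_congruenceSubgroup]
    have e : ((u * h * u⁻¹ : GL (Fin m) D) : Matrix (Fin m) (Fin m) D) - 1 =
        (u : Matrix (Fin m) (Fin m) D) * ((h : Matrix (Fin m) (Fin m) D) - 1) *
          ((u⁻¹ : GL (Fin m) D) : Matrix (Fin m) (Fin m) D) := by
      rw [mul_sub, sub_mul, mul_one, ← Units.val_mul, ← Units.val_mul, ← Units.val_mul,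
        mul_inv_cancel, Units.val_one]
    rw [e]
    exact divisionValuation_mul_apply_lt' F (divisionValuation_mul_apply_lt F hu.1 hh) hu.2
  rw [Subgroup.mem_normalizer_iff]
  refine fun h => ⟨key u hu h, fun hh => ?_⟩
  have := key u⁻¹ ((maxCompact F D m).inv_mem hu) _ hh
  simpa [mul_assoc] using this

theorem weylMatrix_mem_maxCompact (w : Equiv.Perm (Fin m)) :
    weylMatrix D w ∈ maxCompact F D m := by
  have key : ∀ w : Equiv.Perm (Fin m), ∀ i j,
      (weylMatrix D w : Matrix (Fin m) (Fin m) D) i j ∈ integerRing F D := by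
    intro w i j
    change (if i = w j then (1 : D) else 0) ∈ _
    split_ifs
    exacts [Subring.one_mem _, Subring.zero_mem _]
  refine ⟨key w, ?_⟩
  rw [← map_inv]
  exact key w⁻¹

theorem divisionValuation_tauPow_conj (ϖ : Dˣ) (e : Fin m → ℕ) (g : GL (Fin m) D) (i j : Fin m) :
    divisionValuation F D
      ((((tauPow ϖ e * g * (tauPow ϖ e)⁻¹ : GL (Fin m) D) : Matrix (Fin m) (Fin m) D) - 1) i j) =
      divisionValuation F D ϖ ^ e i *
        divisionValuation F D (((g : Matrix (Fin m) (Fin m) D) - 1) i j) *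
          (divisionValuation F D ϖ ^ e j)⁻¹ := by
  have h : ((tauPow ϖ e * g * (tauPow ϖ e)⁻¹ : GL (Fin m) D) : Matrix (Fin m) (Fin m) D) - 1 =
      (tauPow ϖ e : Matrix (Fin m) (Fin m) D) * ((g : Matrix (Fin m) (Fin m) D) - 1) *
        (((tauPow ϖ e)⁻¹ : GL (Fin m) D) : Matrix (Fin m) (Fin m) D) := by
    rw [mul_sub, sub_mul, mul_one, ← Units.val_mul, ← Units.val_mul, ← Units.val_mul,
      mul_inv_cancel, Units.val_one]
  rw [h]
  change divisionValuation F D ((Matrix.diagonal _ * _ * Matrix.diagonal _ :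
    Matrix (Fin m) (Fin m) D) i j) = _
  rw [Matrix.mul_diagonal, Matrix.diagonal_mul, map_mul, map_mul, Units.val_pow_eq_pow_val,
    map_pow, Units.val_inv_eq_inv_val, map_inv₀, Units.val_pow_eq_pow_val, map_pow]

theorem divisionValuation_tauPow_inv_conj (ϖ : Dˣ) (e : Fin m → ℕ) (g : GL (Fin m) D)
    (i j : Fin m) :
    divisionValuation F D
      ((((((tauPow ϖ e)⁻¹ * g * tauPow ϖ e : GL (Fin m) D)) : Matrix (Fin m) (Fin m) D) - 1) i j) =
      (divisionValuation F D ϖ ^ e i)⁻¹ *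
        divisionValuation F D (((g : Matrix (Fin m) (Fin m) D) - 1) i j) *
          divisionValuation F D ϖ ^ e j := by
  have h : (((tauPow ϖ e)⁻¹ * g * tauPow ϖ e : GL (Fin m) D) : Matrix (Fin m) (Fin m) D) - 1 =
      (((tauPow ϖ e)⁻¹ : GL (Fin m) D) : Matrix (Fin m) (Fin m) D) *
        ((g : Matrix (Fin m) (Fin m) D) - 1) * (tauPow ϖ e : Matrix (Fin m) (Fin m) D) := by
    rw [mul_sub, sub_mul, mul_one, ← Units.val_mul, ← Units.val_mul, ← Units.val_mul,
      inv_mul_cancel, Units.val_one]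
  rw [h]
  change divisionValuation F D ((Matrix.diagonal _ * _ * Matrix.diagonal _ :
    Matrix (Fin m) (Fin m) D) i j) = _
  rw [Matrix.mul_diagonal, Matrix.diagonal_mul, map_mul, map_mul, Units.val_pow_eq_pow_val,
    map_pow, Units.val_inv_eq_inv_val, map_inv₀, Units.val_pow_eq_pow_val, map_pow]

end Integral

/-! ### The group `U ∩ w U⁻ w⁻¹` and the product `f_{τ_P} f_{w τ_α w⁻¹}` -/

section DoubleCosetsOfTau

variable (F : Type*) [Field F] [ValuativeRel F] [TopologicalSpace F] [IsNonarchimedeanLocalField F]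
  {D : Type*} [DivisionRing D] [Algebra F D] [FiniteDimensional F D] {m : ℕ}

/-- `N` has integral entries, supported at the positions `(h, k)` with `h < k`, `h ∈ A`,
`k ∉ A`: the matrices `1 + N` form `U ∩ w U⁻ w⁻¹`. -/
structure IsUpperBlock (w : Equiv.Perm (Fin m)) (α : SimpleRoot m)
    (N : Matrix (Fin m) (Fin m) D) : Prop where
  le_one : ∀ h k, divisionValuation F D (N h k) ≤ 1
  supp : ∀ h k, N h k ≠ 0 → h < k ∧ InA w α h ∧ ¬ InA w α k

variable {F}

theorem IsUpperBlock.mul_eq_zero {w : Equiv.Perm (Fin m)} {α : SimpleRoot m}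
    {N N' : Matrix (Fin m) (Fin m) D} (hN : IsUpperBlock F w α N) (hN' : IsUpperBlock F w α N') :
    N * N' = 0 :=
  mul_eq_zero_of_block (InA w α) (fun h k hne => (hN.supp h k hne).2.2)
    (fun h k hne => (hN'.supp h k hne).2.1)

theorem unipOfSqZero_mem_maxCompact {N : Matrix (Fin m) (Fin m) D} (hN : N * N = 0)
    (hN1 : ∀ h k, divisionValuation F D (N h k) ≤ 1) :
    unipOfSqZero N hN ∈ maxCompact F D m :=
  ⟨fun i j => (divisionValuation F D).map_add_le (divisionValuation_one_apply_le F i j) (hN1 i j),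
    fun i j => (divisionValuation F D).map_sub_le (divisionValuation_one_apply_le F i j) (hN1 i j)⟩

theorem IsUpperBlock.mem_inter {w : Equiv.Perm (Fin m)} {α : SimpleRoot m}
    {N : Matrix (Fin m) (Fin m) D} (hN : IsUpperBlock F w α N) :
    unipOfSqZero N (hN.mul_eq_zero hN) ∈ upperUnipotent F D m ∩
      (fun g => weylMatrix D w * g * (weylMatrix D w)⁻¹) '' lowerUnipotent F D m := by
  set u := unipOfSqZero N (hN.mul_eq_zero hN) with hu
  have huK : u ∈ maxCompact F D m := unipOfSqZero_mem_maxCompact _ hN.le_one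
  have hdiag : ∀ h, (u : Matrix (Fin m) (Fin m) D) h h = 1 := by
    intro h
    have : N h h = 0 := by
      by_contra hne
      exact lt_irrefl _ (hN.supp h h hne).1
    rw [hu, unipOfSqZero_val, Matrix.add_apply, this, Matrix.one_apply_eq, add_zero]
  have hoff : ∀ h k, h ≠ k → (u : Matrix (Fin m) (Fin m) D) h k = N h k := by
    intro h k hne
    rw [hu, unipOfSqZero_val, Matrix.add_apply, Matrix.one_apply_ne hne, zero_add]
  refine ⟨⟨huK, hdiag, fun h k hkh => ?_⟩, (weylMatrix D w)⁻¹ * u * weylMatrix D w,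
    ⟨?_, ?_, ?_⟩, by group⟩
  · rw [hoff h k hkh.ne']
    by_contra hne
    exact lt_asymm hkh (hN.supp h k hne).1
  · have hw := weylMatrix_mem_maxCompact (F := F) (D := D) w
    exact mul_mem (mul_mem (inv_mem hw) huK) hw
  all_goals
    have hconj : ∀ i j, (((weylMatrix D w)⁻¹ * u * weylMatrix D w : GL (Fin m) D) :
        Matrix (Fin m) (Fin m) D) i j = (u : Matrix (Fin m) (Fin m) D) (w i) (w j) := by
      intro i j
      have := weylMatrix_conj_apply w⁻¹ u i j
      rwa [map_inv, inv_inv, inv_inv] at this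
  · intro h
    rw [hconj, hdiag]
  · intro h k hhk
    rw [hconj, hoff _ _ (w.injective.ne hhk.ne)]
    by_contra hne
    obtain ⟨-, h1, h2⟩ := hN.supp _ _ hne
    have hinv : ∀ x, w⁻¹ (w x) = x := w.symm_apply_apply
    simp only [InA, hinv] at h1 h2
    omega

theorem exists_isUpperBlock_of_mem_inter {w : Equiv.Perm (Fin m)} {α : SimpleRoot m}
    (hw : IsMinimalInCoset {β : SimpleRoot m | β ≠ α} w) {u : GL (Fin m) D}
    (hu : u ∈ upperUnipotent F D m ∩
      (fun g => weylMatrix D w * g * (weylMatrix D w)⁻¹) '' lowerUnipotent F D m) :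
    ∃ (N : Matrix (Fin m) (Fin m) D) (hN : IsUpperBlock F w α N),
      u = unipOfSqZero N (hN.mul_eq_zero hN) := by
  obtain ⟨⟨huK, hdiag, hup⟩, g, ⟨-, -, hglow⟩, hg⟩ := hu
  have hN : IsUpperBlock F w α ((u : Matrix (Fin m) (Fin m) D) - 1) := by
    refine ⟨fun h k => (divisionValuation F D).map_sub_le (huK.1 h k)
      (divisionValuation_one_apply_le F h k), fun h k hne => ?_⟩
    have hhk : h ≠ k := by
      rintro rfl
      exact hne (by rw [Matrix.sub_apply, hdiag, Matrix.one_apply_eq, sub_self])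
    rw [Matrix.sub_apply, Matrix.one_apply_ne hhk, sub_zero] at hne
    have hlt : h < k := lt_of_le_of_ne (not_lt.1 fun hlt => hne (hup h k hlt)) hhk
    have hlt' : w⁻¹ k < w⁻¹ h := by
      refine lt_of_le_of_ne (not_lt.1 fun hlt' => hne ?_) (w⁻¹.injective.ne hhk.symm)
      rw [← hg]
      exact (weylMatrix_conj_apply w g h k).trans (hglow _ _ hlt')
    have hinv : ∀ x, w (w⁻¹ x) = x := w.apply_symm_apply
    have hcross : ¬ ((w⁻¹ k : ℕ) < α.1 → (w⁻¹ h : ℕ) < α.1) := fun h' => by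
      have := hw.lt_of_lt hlt' h'
      rw [hinv, hinv] at this
      exact lt_asymm hlt this
    simp only [InA]
    exact ⟨hlt, by omega, by omega⟩
  refine ⟨_, hN, Units.ext ?_⟩
  rw [unipOfSqZero_val]; abel

/-- The matrix whose entries at the positions `(h, k)`, `k < h`, `h ∉ A`, `k ∈ A` are given by `c`
and whose other entries vanish. -/
noncomputable def lowMatrix (w : Equiv.Perm (Fin m)) (α : SimpleRoot m)
    (c : LowPosition w α → D) : Matrix (Fin m) (Fin m) D :=
  Matrix.of fun h k => if hp : k < h ∧ ¬ InA w α h ∧ InA w α k then c ⟨(h, k), hp⟩ else 0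

theorem lowMatrix_apply_position (w : Equiv.Perm (Fin m)) (α : SimpleRoot m)
    (c : LowPosition w α → D) (p : LowPosition w α) : lowMatrix w α c p.1.1 p.1.2 = c p :=
  dif_pos p.2

theorem lowMatrix_apply_of_not (w : Equiv.Perm (Fin m)) (α : SimpleRoot m)
    (c : LowPosition w α → D) {h k : Fin m} (hp : ¬ (k < h ∧ ¬ InA w α h ∧ InA w α k)) :
    lowMatrix w α c h k = 0 := dif_neg hp

theorem lowMatrix_mul_lowMatrix (w : Equiv.Perm (Fin m)) (α : SimpleRoot m)
    (c c' : LowPosition w α → D) : lowMatrix w α c * lowMatrix w α c' = 0 := by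
  refine mul_eq_zero_of_block (fun h => ¬ InA w α h) (fun h k hne => ?_) (fun h k hne => ?_)
  · by_contra hk
    exact hne (lowMatrix_apply_of_not w α c fun hp => hk hp.2.2)
  · by_contra hk
    exact hne (lowMatrix_apply_of_not w α c' fun hp => hp.2.1 hk)

theorem lowMatrix_le_one {w : Equiv.Perm (Fin m)} {α : SimpleRoot m} {c : LowPosition w α → D}
    (hc : ∀ p, divisionValuation F D (c p) ≤ 1) (h k : Fin m) :
    divisionValuation F D (lowMatrix w α c h k) ≤ 1 := by
  by_cases hp : k < h ∧ ¬ InA w α h ∧ InA w α k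
  · exact (congrArg _ (lowMatrix_apply_position w α c ⟨(h, k), hp⟩)).trans_le (hc _)
  · rw [lowMatrix_apply_of_not w α c hp, map_zero]; exact zero_le

/-- The unipotent matrix `1 + N` with `N` supported below the diagonal on the block
`Aᶜ × A`. -/
noncomputable def lowUnip (w : Equiv.Perm (Fin m)) (α : SimpleRoot m)
    (c : LowPosition w α → D) : GL (Fin m) D :=
  unipOfSqZero (lowMatrix w α c) (lowMatrix_mul_lowMatrix w α c c)

theorem lowUnip_sub_one (w : Equiv.Perm (Fin m)) (α : SimpleRoot m) (c : LowPosition w α → D) :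
    (lowUnip w α c : Matrix (Fin m) (Fin m) D) - 1 = lowMatrix w α c :=
  add_sub_cancel_left _ _

theorem lowUnip_inv_mul_mem_iff (w : Equiv.Perm (Fin m)) (α : SimpleRoot m)
    (c c' : LowPosition w α → D) :
    (lowUnip w α c)⁻¹ * lowUnip w α c' ∈ congruenceSubgroup F D m ↔
      ∀ p, divisionValuation F D (c' p - c p) < 1 := by
  have e : (((lowUnip w α c)⁻¹ * lowUnip w α c' : GL (Fin m) D) : Matrix (Fin m) (Fin m) D) - 1 =
      lowMatrix w α c' - lowMatrix w α c := by
    change (1 - lowMatrix w α c) * (1 + lowMatrix w α c') - 1 = _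
    have := lowMatrix_mul_lowMatrix w α c c'
    rw [sub_mul, one_mul, mul_add, mul_one, this]; abel
  rw [mem_congruenceSubgroup, e]
  constructor
  · intro h p
    rw [← lowMatrix_apply_position w α c, ← lowMatrix_apply_position w α c']
    exact h p.1.1 p.1.2
  · intro hc h k
    rw [Matrix.sub_apply]
    by_cases hp : k < h ∧ ¬ InA w α h ∧ InA w α k
    · have := hc ⟨(h, k), hp⟩
      rwa [← lowMatrix_apply_position w α c, ← lowMatrix_apply_position w α c'] at this
    · rw [lowMatrix_apply_of_not w α c hp, lowMatrix_apply_of_not w α c' hp]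
      simp

/-- The exponent `1` at the indices in `A`, `0` elsewhere: `w τ_α w⁻¹ = diag(ϖ ^ e)`. -/
def expA (w : Equiv.Perm (Fin m)) (α : SimpleRoot m) (k : Fin m) : ℕ :=
  if InA w α k then 1 else 0

/-- The exponents of `τ_P`. -/
def expP (w : Equiv.Perm (Fin m)) (α : SimpleRoot m) (k : Fin m) : ℕ :=
  tauExponent (setP w α) k

theorem expP_mono (w : Equiv.Perm (Fin m)) (α : SimpleRoot m) {i j : Fin m} (h : i ≤ j) :
    expP w α i ≤ expP w α j := tauExponent_mono _ h

theorem tauPow_expP_mul_expA (w : Equiv.Perm (Fin m)) (α : SimpleRoot m) (ϖ : Dˣ) :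
    tauPow ϖ (expP w α) * tauPow ϖ (expA w α) = tauSet m ϖ (setQ w α) := by
  rw [tauPow_mul, tauSet_eq_tauPow]
  congr 1
  ext k
  exact (tauExponent_setQ w α k).symm

theorem tau_lowUnip_mem {ϖ : Dˣ} (hϖ : IsDivisionUniformizer F ϖ) {w : Equiv.Perm (Fin m)}
    {α : SimpleRoot m} {c : LowPosition w α → D} (hc : ∀ p, divisionValuation F D (c p) ≤ 1) :
    tauPow ϖ (expP w α) * lowUnip w α c ∈ DoubleCoset.doubleCoset (tauPow ϖ (expP w α))
        (congruenceSubgroup F D m : Set (GL (Fin m) D)) (congruenceSubgroup F D m) ∧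
      (tauPow ϖ (expP w α) * lowUnip w α c)⁻¹ * (tauPow ϖ (expP w α) * tauPow ϖ (expA w α)) ∈
        DoubleCoset.doubleCoset (tauPow ϖ (expA w α))
          (congruenceSubgroup F D m : Set (GL (Fin m) D)) (congruenceSubgroup F D m) := by
  have hp0 : divisionValuation F D ϖ ≠ 0 := (Valuation.ne_zero_iff _).2 ϖ.ne_zero
  set τ := tauPow ϖ (expP w α) with hτ
  set t := tauPow ϖ (expA w α) with ht
  set V := lowUnip w α c with hV
  have h1 : τ * V * τ⁻¹ ∈ congruenceSubgroup F D m := by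
    rw [mem_congruenceSubgroup]
    intro i j
    rw [hτ, divisionValuation_tauPow_conj, hV, lowUnip_sub_one]
    by_cases hp : j < i ∧ ¬ InA w α i ∧ InA w α j
    · exact pow_mul_lt_one' hp0 hϖ.lt_one (lowMatrix_le_one hc i j)
        (tauExponent_setP_lt w α hp.1 hp.2.2 hp.2.1)
    · rw [lowMatrix_apply_of_not w α c hp]; simp
  have h2 : t⁻¹ * V * t ∈ congruenceSubgroup F D m := by
    rw [mem_congruenceSubgroup]
    intro i j
    rw [ht, divisionValuation_tauPow_inv_conj, hV, lowUnip_sub_one]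
    by_cases hp : j < i ∧ ¬ InA w α i ∧ InA w α j
    · simp only [expA, hp.2.1, hp.2.2, if_true, if_false, pow_zero, pow_one, inv_one, one_mul]
      exact mul_lt_one_of_nonneg_of_lt_one_right (lowMatrix_le_one hc i j) zero_le hϖ.lt_one
    · rw [lowMatrix_apply_of_not w α c hp]; simp
  rw [DoubleCoset.mem_doubleCoset, DoubleCoset.mem_doubleCoset]
  exact ⟨⟨_, h1, 1, one_mem _, by group⟩, 1, one_mem _, _, inv_mem h2, by group⟩

/-- The cosets counted by the value of `f_{τ_P} f_{w τ_α w⁻¹}` at `τ_Q` are those of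
`τ_P (1 + N)` with `N` integral and supported below the diagonal on `Aᶜ × A`. -/
theorem exists_lowUnip_of_mem {ϖ : Dˣ} (hϖ : IsDivisionUniformizer F ϖ) {w : Equiv.Perm (Fin m)}
    {α : SimpleRoot m} {z : GL (Fin m) D}
    (hz1 : z ∈ DoubleCoset.doubleCoset (tauPow ϖ (expP w α))
        (congruenceSubgroup F D m : Set (GL (Fin m) D)) (congruenceSubgroup F D m))
    (hz2 : z⁻¹ * (tauPow ϖ (expP w α) * tauPow ϖ (expA w α)) ∈
        DoubleCoset.doubleCoset (tauPow ϖ (expA w α))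
          (congruenceSubgroup F D m : Set (GL (Fin m) D)) (congruenceSubgroup F D m)) :
    ∃ c : LowPosition w α → D, (∀ p, divisionValuation F D (c p) ≤ 1) ∧
      (tauPow ϖ (expP w α) * lowUnip w α c)⁻¹ * z ∈ congruenceSubgroup F D m := by
  have hp0 : divisionValuation F D ϖ ≠ 0 := (Valuation.ne_zero_iff _).2 ϖ.ne_zero
  have hp1 := hϖ.lt_one
  set v := divisionValuation F D
  set τ := tauPow ϖ (expP w α) with hτ
  set t := tauPow ϖ (expA w α) with ht
  rw [DoubleCoset.mem_doubleCoset] at hz1 hz2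
  obtain ⟨k, hk, k', hk', rfl⟩ := hz1
  obtain ⟨b, hb, b', hb', e⟩ := hz2
  -- `g` lies both in `τ⁻¹ K¹ τ` and in `t K¹ t⁻¹ K¹`; each membership bounds some of its entries
  set g := τ⁻¹ * k * τ with hg
  set B := t * b'⁻¹ * t⁻¹ with hB
  have hgB : g = B * (k' * b)⁻¹ := by
    have h1 : k' * b * t * b' * t⁻¹ = g⁻¹ := by
      calc k' * b * t * b' * t⁻¹ = k' * (b * t * b') * t⁻¹ := by group
        _ = g⁻¹ := by rw [← e, hg]; group
    rw [← inv_inv g, ← h1, hB]; group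
  have hB1 : ∀ i j, v (((B : Matrix (Fin m) (Fin m) D) - 1) i j) ≤ 1 ∧
      (¬ (¬ InA w α i ∧ InA w α j) → v (((B : Matrix (Fin m) (Fin m) D) - 1) i j) < 1) := by
    intro i j
    have hb1 := (mem_congruenceSubgroup F D).1 (inv_mem hb') i j
    rw [hB, ht, divisionValuation_tauPow_conj]
    by_cases hij : ¬ InA w α i ∧ InA w α j
    · refine ⟨?_, fun h => absurd hij h⟩
      simp only [expA, hij.1, hij.2, if_true, if_false, pow_zero, pow_one, one_mul]
      exact mul_inv_le_one_of_le₀ ((hϖ.lt_one_iff _).1 hb1) zero_le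
    · have := pow_mul_lt_one hp0 hp1 hb1 (a := expA w α i) (b := expA w α j) (by
        simp only [expA]; split_ifs <;> first | omega | tauto)
      exact ⟨this.le, fun _ => this⟩
  have hBint : ∀ i j, v ((B : Matrix (Fin m) (Fin m) D) i j) ≤ 1 := fun i j => by
    have := v.map_add_le (hB1 i j).1 (divisionValuation_one_apply_le F i j)
    rwa [← Matrix.add_apply, sub_add_cancel] at this
  have hg1 : (g : Matrix (Fin m) (Fin m) D) - 1 = ((B : Matrix (Fin m) (Fin m) D) - 1) +
      (B : Matrix (Fin m) (Fin m) D) *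
        ((((k' * b)⁻¹ : GL (Fin m) D) : Matrix (Fin m) (Fin m) D) - 1) := by
    rw [hgB, Units.val_mul, mul_sub, mul_one]; abel
  have hrest := divisionValuation_mul_apply_lt F hBint (inv_mem (mul_mem hk' hb))
  have hgle : ∀ i j, v (((g : Matrix (Fin m) (Fin m) D) - 1) i j) ≤ 1 := fun i j => by
    rw [hg1]; exact v.map_add_le (hB1 i j).1 (hrest i j).le
  have hglt : ∀ i j, ¬ (j < i ∧ ¬ InA w α i ∧ InA w α j) →
      v (((g : Matrix (Fin m) (Fin m) D) - 1) i j) < 1 := by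
    intro i j hij
    by_cases hlt : j < i
    · rw [hg1]; exact v.map_add_lt ((hB1 i j).2 fun h => hij ⟨hlt, h⟩) (hrest i j)
    · rw [hg, hτ, divisionValuation_tauPow_inv_conj, mul_right_comm, mul_comm, mul_comm _ (_ ^ _),
        ← mul_assoc, mul_comm _ (_ ^ _)]
      exact pow_mul_lt_one hp0 hp1 (hk i j) (expP_mono w α (not_lt.1 hlt))
  set c : LowPosition w α → D := fun p => ((g : Matrix (Fin m) (Fin m) D) - 1) p.1.1 p.1.2 with hc
  refine ⟨c, fun p => hgle _ _, ?_⟩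
  suffices h : (lowUnip w α c)⁻¹ * g ∈ congruenceSubgroup F D m by
    have e2 : (τ * lowUnip w α c)⁻¹ * (k * τ * k') = (lowUnip w α c)⁻¹ * g * k' := by
      rw [hg]; group
    rw [e2]
    exact mul_mem h hk'
  have e3 : (((lowUnip w α c)⁻¹ * g : GL (Fin m) D) : Matrix (Fin m) (Fin m) D) - 1 =
      (((lowUnip w α c)⁻¹ : GL (Fin m) D) : Matrix (Fin m) (Fin m) D) *
        ((g : Matrix (Fin m) (Fin m) D) - 1 - lowMatrix w α c) := by
    rw [← lowUnip_sub_one, sub_sub_sub_cancel_right, mul_sub, ← Units.val_mul, ← Units.val_mul,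
      inv_mul_cancel, Units.val_one]
  rw [mem_congruenceSubgroup, e3]
  refine divisionValuation_mul_apply_lt F ?_ fun i j => ?_
  · exact (inv_mem (unipOfSqZero_mem_maxCompact (lowMatrix_mul_lowMatrix w α c c)
      (lowMatrix_le_one fun p => hgle _ _))).1
  · rw [Matrix.sub_apply]
    by_cases hp : j < i ∧ ¬ InA w α i ∧ InA w α j
    · have := lowMatrix_apply_position w α c ⟨(i, j), hp⟩
      dsimp only at this
      rw [this, hc, sub_self, map_zero]
      exact zero_lt_one
    · rw [lowMatrix_apply_of_not w α c hp, sub_zero]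
      exact hglt i j hp

/-- The value of `f_{τ_P} f_{w τ_α w⁻¹}` at `τ_Q` is `q ^ ℓ(w)`. -/
theorem ncard_cosets_eq {ϖ : Dˣ} (hϖ : IsDivisionUniformizer F ϖ) {w : Equiv.Perm (Fin m)}
    {α : SimpleRoot m} (hw : IsMinimalInCoset {β : SimpleRoot m | β ≠ α} w) :
    ((QuotientGroup.mk : GL (Fin m) D → GL (Fin m) D ⧸ congruenceSubgroup F D m) ''
      {z | z ∈ DoubleCoset.doubleCoset (tauPow ϖ (expP w α))
          (congruenceSubgroup F D m : Set (GL (Fin m) D)) (congruenceSubgroup F D m) ∧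
        z⁻¹ * (tauPow ϖ (expP w α) * tauPow ϖ (expA w α)) ∈
          DoubleCoset.doubleCoset (tauPow ϖ (expA w α))
            (congruenceSubgroup F D m : Set (GL (Fin m) D)) (congruenceSubgroup F D m)}).ncard =
      residueCard F D ^ weylLength w := by
  let Ψ : (LowPosition w α → integerRing F D ⧸ integerPrime F D) →
      GL (Fin m) D ⧸ congruenceSubgroup F D m := fun c =>
    QuotientGroup.mk (tauPow ϖ (expP w α) * lowUnip w α fun p => ((c p).out : D))
  have hmk : ∀ a b : integerRing F D, (Submodule.Quotient.mk a : integerRing F D ⧸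
      integerPrime F D) = Submodule.Quotient.mk b ↔ divisionValuation F D ((a : D) - b) < 1 :=
    fun a b => Submodule.Quotient.eq _
  have hout : ∀ a : integerRing F D ⧸ integerPrime F D, Submodule.Quotient.mk a.out = a :=
    fun a => Quotient.out_eq a
  have hΨ : ∀ c c' : LowPosition w α → D,
      (QuotientGroup.mk (tauPow ϖ (expP w α) * lowUnip w α c) :
        GL (Fin m) D ⧸ congruenceSubgroup F D m) =
          QuotientGroup.mk (tauPow ϖ (expP w α) * lowUnip w α c') ↔
        ∀ p, divisionValuation F D (c' p - c p) < 1 := by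
    intro c c'
    rw [QuotientGroup.eq, ← lowUnip_inv_mul_mem_iff, mul_inv_rev, mul_assoc, inv_mul_cancel_left]
  have hinj : Function.Injective Ψ := by
    intro c c' h
    funext p
    rw [← hout (c p), ← hout (c' p)]
    exact ((hmk _ _).2 ((hΨ _ _).1 h p)).symm
  have hrange : (QuotientGroup.mk : GL (Fin m) D → GL (Fin m) D ⧸ congruenceSubgroup F D m) ''
      {z | z ∈ DoubleCoset.doubleCoset (tauPow ϖ (expP w α))
          (congruenceSubgroup F D m : Set (GL (Fin m) D)) (congruenceSubgroup F D m) ∧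
        z⁻¹ * (tauPow ϖ (expP w α) * tauPow ϖ (expA w α)) ∈
          DoubleCoset.doubleCoset (tauPow ϖ (expA w α))
            (congruenceSubgroup F D m : Set (GL (Fin m) D)) (congruenceSubgroup F D m)} =
      Set.range Ψ := by
    ext y
    constructor
    · rintro ⟨z, ⟨hz1, hz2⟩, rfl⟩
      obtain ⟨c, hc, hcz⟩ := exists_lowUnip_of_mem hϖ hz1 hz2
      refine ⟨fun p => Submodule.Quotient.mk ⟨c p, hc p⟩, ?_⟩
      rw [← QuotientGroup.eq.2 hcz]
      exact (hΨ _ _).2 fun p => (hmk ⟨c p, hc p⟩ _).1 (hout _).symm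
    · rintro ⟨c, rfl⟩
      exact ⟨_, tau_lowUnip_mem hϖ fun p => (c p).out.2, rfl⟩
  rw [hrange, ← Nat.card_coe_set_eq, Nat.card_range_of_injective hinj, Nat.card_fun,
    card_lowPosition hw]
  rfl

/-- `t_A` conjugates `U ∩ w U⁻ w⁻¹` into `K¹`. -/
theorem tauPow_expA_conj_mem {ϖ : Dˣ} (hϖ : IsDivisionUniformizer F ϖ) {w : Equiv.Perm (Fin m)}
    {α : SimpleRoot m} {N : Matrix (Fin m) (Fin m) D} (hN : IsUpperBlock F w α N) :
    tauPow ϖ (expA w α) * unipOfSqZero N (hN.mul_eq_zero hN) * (tauPow ϖ (expA w α))⁻¹ ∈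
      congruenceSubgroup F D m := by
  rw [mem_congruenceSubgroup]
  intro i j
  rw [divisionValuation_tauPow_conj, unipOfSqZero_val, add_sub_cancel_left]
  by_cases hne : N i j = 0
  · rw [hne]; simp
  · obtain ⟨-, hi, hj⟩ := hN.supp i j hne
    simp only [expA, hi, hj, if_true, if_false, pow_zero, pow_one, inv_one, mul_one]
    rw [mul_comm]
    exact mul_lt_one_of_nonneg_of_lt_one_right (hN.le_one i j) zero_le hϖ.lt_one

/-- The double cosets of `τ_Q u` and `τ_Q u'` coincide only if `u K¹ = u' K¹`. -/
theorem inv_mul_mem_of_mem_doubleCoset {ϖ : Dˣ} (hϖ : IsDivisionUniformizer F ϖ)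
    {w : Equiv.Perm (Fin m)} {α : SimpleRoot m} {N N' : Matrix (Fin m) (Fin m) D}
    (hN : IsUpperBlock F w α N) (hN' : IsUpperBlock F w α N') {e : Fin m → ℕ} (he : Monotone e)
    (h : tauPow ϖ e * unipOfSqZero N (hN.mul_eq_zero hN) ∈
      DoubleCoset.doubleCoset (tauPow ϖ e * unipOfSqZero N' (hN'.mul_eq_zero hN'))
        (congruenceSubgroup F D m : Set (GL (Fin m) D)) (congruenceSubgroup F D m)) :
    (unipOfSqZero N' (hN'.mul_eq_zero hN'))⁻¹ * unipOfSqZero N (hN.mul_eq_zero hN) ∈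
      congruenceSubgroup F D m := by
  have hp0 : divisionValuation F D ϖ ≠ 0 := (Valuation.ne_zero_iff _).2 ϖ.ne_zero
  set v := divisionValuation F D
  set s := tauPow ϖ e with hs
  set u := unipOfSqZero N (hN.mul_eq_zero hN) with hu
  set u' := unipOfSqZero N' (hN'.mul_eq_zero hN') with hu'
  have huK : u ∈ maxCompact F D m := unipOfSqZero_mem_maxCompact _ hN.le_one
  have huK' : u' ∈ maxCompact F D m := unipOfSqZero_mem_maxCompact _ hN'.le_one
  obtain ⟨k, hk, k', hk', e1⟩ := DoubleCoset.mem_doubleCoset.1 h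
  have hn := Subgroup.mem_normalizer_iff.1 (maxCompact_le_normalizer F huK')
  set b := u' * k'⁻¹ * u'⁻¹ with hb
  have hbH : b ∈ congruenceSubgroup F D m := (hn _).1 (inv_mem hk')
  have hkb : s⁻¹ * k * s = u * u'⁻¹ * b := by
    have : k = s * u * k'⁻¹ * u'⁻¹ * s⁻¹ := by rw [e1]; group
    rw [this, hb]; group
  have huu : ((u * u'⁻¹ : GL (Fin m) D) : Matrix (Fin m) (Fin m) D) - 1 = N - N' := by
    change (1 + N) * (1 - N') - 1 = _
    rw [mul_sub, add_mul 1 N N', one_mul, mul_one, hN.mul_eq_zero hN']; abel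
  suffices hmem : u * u'⁻¹ ∈ congruenceSubgroup F D m by
    refine (hn _).2 ?_
    convert hmem using 1
    group
  rw [mem_congruenceSubgroup]
  intro i j
  by_cases hij : i < j
  · have h1 : ((u * u'⁻¹ : GL (Fin m) D) : Matrix (Fin m) (Fin m) D) - 1 =
        (((s⁻¹ * k * s : GL (Fin m) D) : Matrix (Fin m) (Fin m) D) - 1) -
          ((u * u'⁻¹ : GL (Fin m) D) : Matrix (Fin m) (Fin m) D) *
            ((b : Matrix (Fin m) (Fin m) D) - 1) := by
      rw [hkb, Units.val_mul (u * u'⁻¹) b, mul_sub, mul_one]; abel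
    rw [h1, Matrix.sub_apply]
    refine (v.map_sub _ _).trans_lt (max_lt ?_ ?_)
    · rw [hs, divisionValuation_tauPow_inv_conj, mul_right_comm, mul_comm, mul_comm _ (_ ^ _),
        ← mul_assoc, mul_comm _ (_ ^ _)]
      exact pow_mul_lt_one hp0 hϖ.lt_one (hk i j) (he hij.le)
    · exact divisionValuation_mul_apply_lt F (mul_mem huK (inv_mem huK')).1 hbH i j
  · have h0 : ∀ {M : Matrix (Fin m) (Fin m) D}, IsUpperBlock F w α M → M i j = 0 := fun hM => by
      by_contra hne
      exact hij (hM.supp i j hne).1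
    rw [huu, Matrix.sub_apply, h0 hN, h0 hN', sub_zero, map_zero]
    exact zero_lt_one

/-- `K¹ τ_P K¹ t_A K¹` is covered by the double cosets of `τ_Q u` with `u ∈ U ∩ w U⁻ w⁻¹`. An
element `h ∈ K¹` is split as `(1 + N₁)(1 + N₂) c`, where `N₁` and `N₂` hold the entries of `h` on
the block `A × Aᶜ` below and above the diagonal; `τ_P` absorbs the first factor, `t_A` absorbs
the last, and `t_A` carries the middle one to `U ∩ w U⁻ w⁻¹`. -/
theorem exists_isUpperBlock_tau_mul {ϖ : Dˣ} (hϖ : IsDivisionUniformizer F ϖ)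
    (w : Equiv.Perm (Fin m)) (α : SimpleRoot m) {h : GL (Fin m) D}
    (hh : h ∈ congruenceSubgroup F D m) :
    ∃ (N : Matrix (Fin m) (Fin m) D) (hN : IsUpperBlock F w α N),
      ∃ a ∈ congruenceSubgroup F D m, ∃ b ∈ congruenceSubgroup F D m,
        tauPow ϖ (expP w α) * h * tauPow ϖ (expA w α) =
          a * (tauPow ϖ (expP w α) * tauPow ϖ (expA w α) *
            unipOfSqZero N (hN.mul_eq_zero hN)) * b := by
  have hp0 : divisionValuation F D ϖ ≠ 0 := (Valuation.ne_zero_iff _).2 ϖ.ne_zero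
  have hp1 := hϖ.lt_one
  set v := divisionValuation F D
  set τ := tauPow ϖ (expP w α) with hτ
  set t := tauPow ϖ (expA w α) with ht
  set M : Matrix (Fin m) (Fin m) D := (h : Matrix (Fin m) (Fin m) D) - 1 with hM
  let N₁ : Matrix (Fin m) (Fin m) D := Matrix.of fun i j =>
    if InA w α i ∧ ¬ InA w α j ∧ j < i then M i j else 0
  let N₂ : Matrix (Fin m) (Fin m) D := Matrix.of fun i j =>
    if InA w α i ∧ ¬ InA w α j ∧ i < j then M i j else 0
  let N₃ : Matrix (Fin m) (Fin m) D := Matrix.of fun i j =>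
    if InA w α i ∧ ¬ InA w α j ∧ i < j then (ϖ⁻¹ : Dˣ) * M i j else 0
  have hN₁ : ∀ i j, N₁ i j ≠ 0 → InA w α i ∧ ¬ InA w α j := fun i j hne => by
    by_contra hcon
    exact hne (if_neg fun hc => hcon ⟨hc.1, hc.2.1⟩)
  have hN₂ : ∀ i j, N₂ i j ≠ 0 → InA w α i ∧ ¬ InA w α j := fun i j hne => by
    by_contra hcon
    exact hne (if_neg fun hc => hcon ⟨hc.1, hc.2.1⟩)
  have h11 : N₁ * N₁ = 0 := mul_eq_zero_of_block (InA w α) (fun i j hne => (hN₁ i j hne).2)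
    (fun i j hne => (hN₁ i j hne).1)
  have h22 : N₂ * N₂ = 0 := mul_eq_zero_of_block (InA w α) (fun i j hne => (hN₂ i j hne).2)
    (fun i j hne => (hN₂ i j hne).1)
  have h21 : N₂ * N₁ = 0 := mul_eq_zero_of_block (InA w α) (fun i j hne => (hN₂ i j hne).2)
    (fun i j hne => (hN₁ i j hne).1)
  have hMlt : ∀ i j, v (M i j) < 1 := hh
  have hN₃ : IsUpperBlock F w α N₃ := by
    refine ⟨fun i j => ?_, fun i j hne => ?_⟩
    · simp only [N₃, Matrix.of_apply]
      split_ifs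
      · rw [map_mul, Units.val_inv_eq_inv_val, map_inv₀, mul_comm]
        exact mul_inv_le_one_of_le₀ ((hϖ.lt_one_iff _).1 (hMlt i j)) zero_le
      · rw [map_zero]; exact zero_le
    · by_contra hcon
      exact hne (if_neg fun hc => hcon ⟨hc.2.2, hc.1, hc.2.1⟩)
  set u₁ := unipOfSqZero N₁ h11 with hu₁
  set u₂ := unipOfSqZero N₂ h22 with hu₂
  set u₃ := unipOfSqZero N₃ (hN₃.mul_eq_zero hN₃) with hu₃
  have h23 : u₂ * t = t * u₃ := by
    apply Units.ext
    change (1 + N₂) * Matrix.diagonal _ = Matrix.diagonal _ * (1 + N₃)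
    rw [add_mul, mul_add, one_mul, mul_one]
    congr 1
    ext i j
    rw [Matrix.mul_diagonal, Matrix.diagonal_mul]
    simp only [N₂, N₃, Matrix.of_apply]
    split_ifs with hij
    · simp [expA, hij.1, hij.2.1]
    · simp
  have h1 : τ * u₁ * τ⁻¹ ∈ congruenceSubgroup F D m := by
    rw [mem_congruenceSubgroup]
    intro i j
    rw [hτ, divisionValuation_tauPow_conj, hu₁, unipOfSqZero_val, add_sub_cancel_left]
    simp only [N₁, Matrix.of_apply]
    split_ifs with hij
    · exact pow_mul_lt_one hp0 hp1 (hMlt i j) (expP_mono w α hij.2.2.le)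
    · simp
  set c := u₂⁻¹ * u₁⁻¹ * h with hc
  have hNlt : ∀ i j, v ((N₁ + N₂) i j) < 1 := fun i j => by
    refine v.map_add_lt ?_ ?_
    · simp only [N₁, Matrix.of_apply]
      split_ifs
      · exact hMlt i j
      · simp
    · simp only [N₂, Matrix.of_apply]
      split_ifs
      · exact hMlt i j
      · simp
  have hc1 : (c : Matrix (Fin m) (Fin m) D) - 1 = M - (N₁ + N₂) - (N₁ + N₂) * M := by
    have : (h : Matrix (Fin m) (Fin m) D) = 1 + M := by rw [hM]; abel
    rw [hc, Units.val_mul, Units.val_mul, this]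
    change (1 - N₂) * (1 - N₁) * (1 + M) - 1 = _
    rw [sub_mul 1 N₂, one_mul, mul_sub N₂, mul_one, h21]
    noncomm_ring
  -- on the block `A × Aᶜ` the entries of `c - 1` lie in `℘²`
  have hprod : ∀ i j, v (((N₁ + N₂) * M) i j) ≤ v ϖ * v ϖ := fun i j => by
    rw [Matrix.mul_apply]
    refine v.map_sum_le fun k _ => ?_
    rw [map_mul]
    exact mul_le_mul' ((hϖ.lt_one_iff _).1 (hNlt i k)) ((hϖ.lt_one_iff _).1 (hMlt k j))
  have h2 : t⁻¹ * c * t ∈ congruenceSubgroup F D m := by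
    rw [mem_congruenceSubgroup]
    intro i j
    rw [ht, divisionValuation_tauPow_inv_conj, hc1]
    by_cases hij : InA w α i ∧ ¬ InA w α j
    · have hne : i ≠ j := fun e => hij.2 (e ▸ hij.1)
      have h0 : (M - (N₁ + N₂)) i j = 0 := by
        simp only [N₁, N₂, Matrix.sub_apply, Matrix.add_apply, Matrix.of_apply, hij.1, hij.2,
          not_false_eq_true, true_and]
        rcases lt_or_gt_of_ne hne with hlt | hlt
        · simp [hlt, hlt.not_gt]
        · simp [hlt, hlt.not_gt]
      rw [Matrix.sub_apply, h0, zero_sub, Valuation.map_neg]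
      simp only [expA, hij.1, hij.2, if_true, if_false, pow_zero, pow_one, mul_one]
      calc (v ϖ)⁻¹ * v (((N₁ + N₂) * M) i j) ≤ (v ϖ)⁻¹ * (v ϖ * v ϖ) :=
            mul_le_mul_right (hprod i j) _
        _ = v ϖ := inv_mul_cancel_left₀ hp0 _
        _ < 1 := hp1
    · have hlt : v ((M - (N₁ + N₂) - (N₁ + N₂) * M) i j) < 1 := by
        rw [Matrix.sub_apply, Matrix.sub_apply]
        refine (v.map_sub _ _).trans_lt (max_lt
          ((v.map_sub _ _).trans_lt (max_lt (hMlt i j) (hNlt i j))) ?_)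
        exact (hprod i j).trans_lt (mul_lt_one_of_nonneg_of_lt_one_right hp1.le zero_le hp1)
      rw [mul_right_comm, mul_comm, mul_comm _ (_ ^ _), ← mul_assoc, mul_comm _ (_ ^ _)]
      refine pow_mul_lt_one hp0 hp1 hlt ?_
      simp only [expA]
      split_ifs <;> first | omega | tauto
  refine ⟨N₃, hN₃, _, h1, _, h2, ?_⟩
  calc τ * h * t = τ * u₁ * (u₂ * t) * (t⁻¹ * c * t) := by rw [hc]; group
    _ = τ * u₁ * τ⁻¹ * (τ * t * u₃) * (t⁻¹ * c * t) := by rw [h23]; group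

end DoubleCosetsOfTau

theorem mainTheorem4 (F : Type*) [Field F] [ValuativeRel F] [TopologicalSpace F]
    [IsNonarchimedeanLocalField F] (D : Type*) [DivisionRing D] [Algebra F D]
    [Algebra.IsCentral F D] [FiniteDimensional F D] (m : ℕ)
    (ϖ : Dˣ) (hϖ : IsDivisionUniformizer F ϖ)
    (α : SimpleRoot m) (w : Equiv.Perm (Fin m))
    (hw : IsMinimalInCoset {β : SimpleRoot m | β ≠ α} w) :
    ∃ hH : IsHeckePair (congruenceSubgroup F D m),
      ∀ R : Set (GL (Fin m) D),
        IsCosetRepresentatives (congruenceSubgroup F D m)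
          (upperUnipotent F D m ∩
            (fun g => weylMatrix D w * g * (weylMatrix D w)⁻¹) '' lowerUnipotent F D m) R →
        R.Finite ∧
          heckeChar hH (tauSet m ϖ (setP w α)) * heckeChar hH (weylMatrix D w) *
              heckeChar hH (tau m ϖ α.1) * heckeChar hH (weylMatrix D w)⁻¹ =
            (residueCard F D ^ weylLength w) •
              (heckeChar hH (tauSet m ϖ (setQ w α)) * ∑ᶠ u ∈ R, heckeChar hH u) := by
  refine ⟨isHeckePair_congruenceSubgroup F D, fun R hR => ?_⟩
  set hH := isHeckePair_congruenceSubgroup F D (m := m)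
  have hRK : ∀ u ∈ R, u ∈ maxCompact F D m := fun u hu => (hR.1 hu).1.1
  have hRuniq : ∀ u ∈ R, ∀ u' ∈ R, u'⁻¹ * u ∈ congruenceSubgroup F D m → u = u' :=
    fun u hu u' hu' h => (hR.2 u (hR.1 hu)).unique ⟨hu, by simp⟩ ⟨hu', h⟩
  have hp0 : divisionValuation F D ϖ ≠ 0 := (Valuation.ne_zero_iff _).2 ϖ.ne_zero
  have hRfin : R.Finite := by
    have := finite_image_of_close F D hp0 (X := R) id (fun u hu => (hRK u hu).1)
      fun u hu u' hu' hclose => (hRuniq u' hu' u hu ?_).symm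
    · simpa using this
    · rw [mem_congruenceSubgroup]
      have e : ((u⁻¹ * u' : GL (Fin m) D) : Matrix (Fin m) (Fin m) D) - 1 =
          ((u⁻¹ : GL (Fin m) D) : Matrix (Fin m) (Fin m) D) *
            ((u' : Matrix (Fin m) (Fin m) D) - (u : Matrix (Fin m) (Fin m) D)) := by
        rw [mul_sub, ← Units.val_mul, ← Units.val_mul, inv_mul_cancel, Units.val_one]
      rw [e]
      refine divisionValuation_mul_apply_lt F (hRK u hu).2 fun i j => ?_
      rw [Matrix.sub_apply, Valuation.map_sub_swap]
      exact (hclose i j).trans_lt hϖ.lt_one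
  refine ⟨hRfin, ?_⟩
  have hwn := maxCompact_le_normalizer F (weylMatrix_mem_maxCompact (F := F) (D := D) w)
  rw [mul_assoc, mul_assoc, ← mul_assoc (heckeChar hH (weylMatrix D w)),
    heckeChar_mul_of_normalizer_left hH _ hwn,
    heckeChar_mul_of_normalizer_right hH _ (inv_mem hwn), weylMatrix_conj_tau,
    tauSet_eq_tauPow, ← tauPow_expP_mul_expA]
  refine heckeChar_mul_eq_nsmul_sum hH hRfin (fun u hu => maxCompact_le_normalizer F (hRK u hu))
    (fun u hu => ?_) (fun h hh => ?_) (fun u hu u' hu' h => ?_) (ncard_cosets_eq hϖ hw)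
  · obtain ⟨N, hN, rfl⟩ := exists_isUpperBlock_of_mem_inter hw (hR.1 hu)
    exact tauPow_expA_conj_mem hϖ hN
  · obtain ⟨N, hN, a, ha, b, hb, e⟩ := exists_isUpperBlock_tau_mul hϖ w α hh
    obtain ⟨u, ⟨hu, huN⟩, -⟩ := hR.2 _ hN.mem_inter
    refine ⟨u, hu, DoubleCoset.mem_doubleCoset.2 ⟨a, ha, _, mul_mem huN hb, ?_⟩⟩
    refine e.trans ?_
    simp only [mul_assoc, mul_inv_cancel_left]
    rfl
  · obtain ⟨N, hN, rfl⟩ := exists_isUpperBlock_of_mem_inter hw (hR.1 hu)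
    obtain ⟨N', hN', rfl⟩ := exists_isUpperBlock_of_mem_inter hw (hR.1 hu')
    change tauPow ϖ (expP w α) * tauPow ϖ (expA w α) * _ ∈ DoubleCoset.doubleCoset
      (tauPow ϖ (expP w α) * tauPow ϖ (expA w α) * _) _ _ at h
    rw [tauPow_expP_mul_expA, tauSet_eq_tauPow] at h
    exact hRuniq _ hu _ hu' (inv_mul_mem_of_mem_doubleCoset hϖ hN hN'
      (fun i j hij => tauExponent_mono _ hij) h)
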